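/- Let $W_{YZ|X}$ be the transition law of a discrete memoryless wiretap channel with (non-empty) finite alphabets $\mathcal X,\mathcal Y,\mathcal Z$; $Y$ is the output of the legitimate receiver and $Z$ that of the eavesdropper. Let $(\mathcal R,p_R)$ be a discrete memoryless source, with $\mathcal R$ finite or countable and Shannon entropy $H(R)\in[0,\infty]$. Entropies and mutual informations are in bits. Assume that the eavesdropper's channel is less capable, i.e. $I(X;Z)\le I(X;Y)$ for every input distribution $p_X$. A $(2^{nR},n)$ wiretap code $\mathcal C_n$ consists of a message set $\mathcal M=\{1,\dots,\lceil 2^{nR}\rceil\}$, a deterministic encoding function $e:\mathcal M\times\mathcal R^n\to\mathcal X^n$ and a decoding function $f:\mathcal Y^n\to\mathcal M\cup\{?\}$. The message $M$ is uniform on $\mathcal M$, the sequence $R^n$ is i.i.d. with law $p_R$ and independent of $M$, and $X^n=e(M,R^n)$ is sent over $n$ memoryless uses of $W_{YZ|X}$. Put $P_e(\mathcal C_n)=\mathbb P[f(Y^n)\ne M]$ and $L(\mathcal C_n)=I(M;Z^n)$. A rate $R\ge 0$ is achievable if there are $(2^{nR},n)$ wiretap codes $\mathcal C_n$ with $\lim_{n\to\infty}P_e(\mathcal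 C_n)=0$ and $\lim_{n\to\infty}L(\mathcal C_n)=0$, and the strong secrecy capacity $C_s$ is the supremum of all achievable rates. Then the set of achievable rates is non-empty and bounded, and $$C_s=\max_{p_{UVXYZ}\in\mathcal P}\bigl(I(X;Y|U)-I(X;Z|U)\bigr),$$ where $\mathcal P$ is the set of all distributions, with $U$ and $V$ on arbitrary finite alphabets, that factorize as $p_{UVXYZ}=p_U\,p_{V|U}\,p_{X|V}\,W_{YZ|X}$ and satisfy $I(X;Z|U)\le H(R)$; in particular the maximum is attained. -/

import Mathlib

open Filter Topology
open scoped ENNReal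

noncomputable section

namespace Wiretap

/-! ### Entropy and mutual information, in bits -/

/-- Shannon entropy (in bits) of a distribution on a finite alphabet. -/
def entropy {α : Type*} [Fintype α] (p : PMF α) : ℝ :=
  ∑ a, Real.negMulLog (p a).toReal / Real.log 2

/-- Shannon entropy (in bits) of a distribution on an arbitrary discrete alphabet; it may be
infinite if the alphabet is infinite. -/
def discreteEntropy {α : Type*} (p : PMF α) : ℝ≥0∞ :=
  ∑' a, ENNReal.ofReal (Real.negMulLog (p a).toReal / Real.log 2)

/-- The two entropies agree on finite alphabets. -/
theorem discreteEntropy_eq_ofReal_entropy {α : Type*} [Fintype α] (p : PMF α) :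
    discreteEntropy p = ENNReal.ofReal (entropy p) := by
  unfold discreteEntropy entropy
  rw [tsum_fintype, ENNReal.ofReal_sum_of_nonneg]
  intro a _
  refine div_nonneg (Real.negMulLog_nonneg ENNReal.toReal_nonneg ?_)
    (Real.log_nonneg (by norm_num))
  exact ENNReal.toReal_le_of_le_ofReal zero_le_one (by simpa using p.coe_le_one a)

/-- `H(A)`, the entropy of a random variable `A` on a discrete probability space `(Ω, μ)`. -/
def H {Ω α : Type*} [Fintype α] (μ : PMF Ω) (A : Ω → α) : ℝ :=
  entropy (μ.map A)

/-- Mutual information `I(A;B) = H(A) + H(B) - H(A,B)`. -/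
def mutualInfo {Ω α β : Type*} [Fintype α] [Fintype β] (μ : PMF Ω) (A : Ω → α) (B : Ω → β) : ℝ :=
  H μ A + H μ B - H μ (fun ω => (A ω, B ω))

/-- Conditional mutual information `I(A;B|C) = H(A,C) + H(B,C) - H(A,B,C) - H(C)`. -/
def condMutualInfo {Ω α β γ : Type*} [Fintype α] [Fintype β] [Fintype γ] (μ : PMF Ω)
    (A : Ω → α) (B : Ω → β) (C : Ω → γ) : ℝ :=
  H μ (fun ω => (A ω, C ω)) + H μ (fun ω => (B ω, C ω))
    - H μ (fun ω => (A ω, B ω, C ω)) - H μ C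

/-! ### Product distributions -/

theorem tsum_prod_pmf {α : Type*} : ∀ (n : ℕ) (p : Fin n → PMF α),
    ∑' x : Fin n → α, ∏ i, p i (x i) = 1
  | 0, p => by simp
  | n + 1, p => by
    rw [← (Fin.consEquiv (fun _ : Fin (n + 1) => α)).tsum_eq, ENNReal.tsum_prod']
    simp only [Fin.prod_univ_succ, Fin.consEquiv_apply, Fin.cons_zero, Fin.cons_succ,
      ENNReal.tsum_mul_left, tsum_prod_pmf n (fun i => p i.succ), mul_one, PMF.tsum_coe]

/-- The law of `n` independent random variables, the `i`-th one with law `p i`. -/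
def productPMF {α : Type*} {n : ℕ} (p : Fin n → PMF α) : PMF (Fin n → α) :=
  ⟨fun x => ∏ i, p i (x i), tsum_prod_pmf n p ▸ ENNReal.summable.hasSum⟩

/-! ### The wiretap channel -/

/-- The eavesdropper's channel is less capable than the main channel:
`I(X;Z) ≤ I(X;Y)` for every input distribution. -/
def LessCapable {X Y Z : Type*} [Fintype X] [Fintype Y] [Fintype Z] (W : X → PMF (Y × Z)) : Prop :=
  ∀ p : PMF X,
    let μ : PMF (X × Y × Z) := p.bind fun x => (W x).map fun yz => (x, yz)
    mutualInfo μ (fun ω => ω.1) (fun ω => ω.2.2) ≤ mutualInfo μ (fun ω => ω.1) (fun ω => ω.2.1)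

/-- A wiretap code with `M` messages and blocklength `n`, whose encoder uses `n` symbols of a
source of randomness with alphabet `S`. The decoder outputs `none` to declare an error. -/
structure Code (S X Y : Type*) (M n : ℕ) where
  /-- the (deterministic) encoding function of the message and of the random source symbols -/
  enc : Fin M → (Fin n → S) → (Fin n → X)
  /-- the decoding function -/
  dec : (Fin n → Y) → Option (Fin M)

/-- The joint law of the message and of the channel outputs `(Yⁿ, Zⁿ)`: the message is uniform,
the source symbols are i.i.d. with law `pS` and independent of the message, and the codeword is
sent over `n` memoryless uses of the channel `W`. -/
def Code.law {S X Y Z : Type*} {M n : ℕ} [NeZero M] (C : Code S X Y M n)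
    (W : X → PMF (Y × Z)) (pS : PMF S) : PMF (Fin M × (Fin n → Y × Z)) :=
  (PMF.uniformOfFintype (Fin M)).bind fun m =>
    (productPMF fun _ : Fin n => pS).bind fun s =>
      (productPMF fun i => W (C.enc m s i)).map fun yz => (m, yz)

/-- The average probability of error. -/
def Code.errorProb {S X Y Z : Type*} {M n : ℕ} [NeZero M] (C : Code S X Y M n)
    (W : X → PMF (Y × Z)) (pS : PMF S) : ℝ :=
  ((C.law W pS).toOuterMeasure {ω | C.dec (fun i => (ω.2 i).1) ≠ some ω.1}).toReal

/-- The secrecy leakage `I(M;Zⁿ)`, not normalized by the blocklength. -/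
def Code.leakage {S X Y Z : Type*} [Fintype Z] {M n : ℕ} [NeZero M] (C : Code S X Y M n)
    (W : X → PMF (Y × Z)) (pS : PMF S) : ℝ :=
  mutualInfo (C.law W pS) (fun ω => ω.1) (fun ω i => (ω.2 i).2)

/-- The number of messages `⌈2^(nR)⌉` of a code of rate `R` and blocklength `n`. -/
def numMessages (R : ℝ) (n : ℕ) : ℕ := ⌈(2 : ℝ) ^ ((n : ℝ) * R)⌉₊

instance (R : ℝ) (n : ℕ) : NeZero (numMessages R n) :=
  ⟨(Nat.ceil_pos.2 (by positivity)).ne'⟩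

/-- `R` is an achievable rate, with a strong secrecy criterion. -/
def Achievable {S X Y Z : Type*} [Fintype Z] (W : X → PMF (Y × Z)) (pS : PMF S) (R : ℝ) : Prop :=
  0 ≤ R ∧ ∃ C : ∀ n : ℕ, Code S X Y (numMessages R n) n,
    Tendsto (fun n => (C n).errorProb W pS) atTop (𝓝 0) ∧
    Tendsto (fun n => (C n).leakage W pS) atTop (𝓝 0)

/-- The strong secrecy capacity with rate-limited randomness. -/
def secrecyCapacity {S X Y Z : Type*} [Fintype Z] (W : X → PMF (Y × Z)) (pS : PMF S) : ℝ :=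
  sSup {R | Achievable W pS R}

/-! ### The single-letter expression -/

/-- The distribution `p_U p_{V|U} p_{X|V} W_{YZ|X}` of `(U, V, X, (Y, Z))`. -/
def auxLaw {U V X Y Z : Type*} (pU : PMF U) (pV : U → PMF V) (pX : V → PMF X)
    (W : X → PMF (Y × Z)) : PMF (U × V × X × Y × Z) :=
  pU.bind fun u => (pV u).bind fun v => (pX v).bind fun x => (W x).map fun yz => (u, v, x, yz)

/-- `𝒫`: the distributions of `(U, V, X, Y, Z)`, with `U` and `V` on alphabets of sizes `k` and
`l`, that factorize as `p_U p_{V|U} p_{X|V} W_{YZ|X}` and satisfy `I(X;Z|U) ≤ H(S)`. -/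
def admissible {S X Y Z : Type*} [Fintype X] [Fintype Z] (W : X → PMF (Y × Z)) (pS : PMF S)
    (k l : ℕ) : Set (PMF (Fin k × Fin l × X × Y × Z)) :=
  {μ | (∃ (pU : PMF (Fin k)) (pV : Fin k → PMF (Fin l)) (pX : Fin l → PMF X),
      μ = auxLaw pU pV pX W) ∧
    ENNReal.ofReal (condMutualInfo μ (fun ω => ω.2.2.1) (fun ω => ω.2.2.2.2) (fun ω => ω.1))
      ≤ discreteEntropy pS}

/-- The values of `I(X;Y|U) - I(X;Z|U)` over the distributions in `𝒫`, for all finite alphabets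
of `U` and `V`. -/
def secrecyValues {S X Y Z : Type*} [Fintype X] [Fintype Y] [Fintype Z] (W : X → PMF (Y × Z))
    (pS : PMF S) : Set ℝ :=
  {r | ∃ (k l : ℕ), ∃ μ ∈ admissible W pS k l,
    r = condMutualInfo μ (fun ω => ω.2.2.1) (fun ω => ω.2.2.2.1) (fun ω => ω.1)
      - condMutualInfo μ (fun ω => ω.2.2.1) (fun ω => ω.2.2.2.2) (fun ω => ω.1)}

end Wiretap

end

/-! Everything is measured in nats on real weights. The pairs `(I(X;Y|U), I(X;Z|U))` form the convex
hull `wiretapRegion` of the pairs `(I(X;Y), I(X;Z))` over input laws. The prefix `V` affects neither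
the objective nor the constraint, which see only the law of `X` given `U`. The hull is compact, so
the maximum is attained, and both directions are about points of this hull.

Converse. Fano bounds `log M` by `I(M;Yⁿ)`. Since `M - Xⁿ - Yⁿ Zⁿ` is Markov, `I(M;Yⁿ) - I(M;Zⁿ)`
equals `I(Xⁿ;Yⁿ) - I(Xⁿ;Zⁿ)` minus the same difference given `M`, and the latter is nonnegative when
the eavesdropper is less capable. Also `I(Xⁿ;Zⁿ) = I(M;Zⁿ) + I(Xⁿ;Zⁿ|M)`, and the last term is at
most `n H(R)`, because given `M` the codeword is a function of the source symbols. Both bounds must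
be single-letterized by the same auxiliary variable. `SingleLetter.prod` does so by Csiszár's sum
identity for two channel uses: it preserves the difference of the informations and does not increase
the one to `Z`. Induction gives `n` uses, and it also shows that being less capable tensorizes. A
limit point in the compact hull ends the converse.

Achievability. Draw a time-sharing sequence and, given it, independent codewords indexed by message
and source sequence. Decoding the pair works when `R + t H < I(X;Y|U)`, and the output at `Z` is
nearly independent of the message when `I(X;Z|U) < t H`, where `t` is the fraction of source symbols
in use. Both are one-shot estimates in expectation (`sum_codebook_error_le`,
`sum_codebook_divergence_le`) in terms of power moments of the likelihood ratio and of the source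
law. These factorize over channel uses and decay exponentially once the exponent `s` is small, so
the unnormalized leakage vanishes. Only pairwise independence of codewords enters, and the source
need not be uniform. Scaling the target point towards `0` makes the inequalities strict, and
quantization reduces an infinite source alphabet to a finite one. -/

namespace Wiretap

open Real
open scoped Pointwise

/-! ### Mutual information of unnormalized weights, in nats -/

/-- A stochastic matrix with real entries. -/
structure IsKernel {α β : Type*} [Fintype β] (V : α → β → ℝ) : Prop where
  nonneg : ∀ a b, 0 ≤ V a b
  sum_eq_one : ∀ a, ∑ b, V a b = 1

/-- The mutual information, in nats, between the input and the output of the channel `V` with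
input weight `w`, extended to unnormalized weights as a function homogeneous of degree one. -/
noncomputable def weightInfo {α β : Type*} [Fintype α] [Fintype β] (w : α → ℝ) (V : α → β → ℝ) :
    ℝ :=
  ∑ b, negMulLog (∑ a, w a * V a b) - ∑ a, w a * ∑ b, negMulLog (V a b) - negMulLog (∑ a, w a)

/-- Gibbs' inequality, summed from `log x ≤ x - 1` at `x = b i / a i`. Only `∑ b ≤ ∑ a` is needed,
so the reference may be a subprobability. The condition `hab` is absolute continuity, which must be
assumed because `log 0 = 0`. -/
theorem sum_mul_log_sub_log_nonneg {ι : Type*} [Fintype ι] (a b : ι → ℝ) (ha : ∀ i, 0 ≤ a i)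
    (hb : ∀ i, 0 ≤ b i) (hab : ∀ i, b i = 0 → a i = 0) (h : ∑ i, b i ≤ ∑ i, a i) :
    0 ≤ ∑ i, a i * (log (a i) - log (b i)) := by
  have key : ∀ i, a i - b i ≤ a i * (log (a i) - log (b i)) := by
    intro i
    rcases (ha i).eq_or_lt with h0 | h0
    · simp only [← h0, zero_mul, zero_sub]; linarith [hb i]
    have hbi : 0 < b i := (hb i).lt_of_ne fun h' => h0.ne' (hab i h'.symm)
    have h1 := log_le_sub_one_of_pos (div_pos hbi h0)
    rw [log_div hbi.ne' h0.ne'] at h1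
    have h2 := mul_le_mul_of_nonneg_left h1 h0.le
    have h3 : a i * (b i / a i - 1) = b i - a i := by field_simp
    nlinarith
  calc (0 : ℝ) ≤ ∑ i, (a i - b i) := by rw [Finset.sum_sub_distrib]; linarith
    _ ≤ _ := Finset.sum_le_sum fun i _ => key i

/-- Subadditivity of entropy for unnormalized joint weights. -/
theorem sum_negMulLog_add_le {ι κ : Type*} [Fintype ι] [Fintype κ] (j : ι → κ → ℝ)
    (hj : ∀ i k, 0 ≤ j i k) :
    ∑ i, ∑ k, negMulLog (j i k) + negMulLog (∑ i, ∑ k, j i k) ≤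
      ∑ i, negMulLog (∑ k, j i k) + ∑ k, negMulLog (∑ i, j i k) := by
  set τ := ∑ i, ∑ k, j i k with hτ
  set r : ι → ℝ := fun i => ∑ k, j i k with hr
  set s : κ → ℝ := fun k => ∑ i, j i k with hs
  have hr0 : ∀ i, 0 ≤ r i := fun i => Finset.sum_nonneg fun k _ => hj i k
  have hs0 : ∀ k, 0 ≤ s k := fun k => Finset.sum_nonneg fun i _ => hj i k
  have hτ0 : 0 ≤ τ := Finset.sum_nonneg fun i _ => hr0 i
  have hrτ : ∑ i, r i = τ := rfl
  have hsτ : ∑ k, s k = τ := by rw [hs, hτ, Finset.sum_comm]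
  have hrj : ∀ i k, r i = 0 → j i k = 0 := fun i k h =>
    (Finset.sum_eq_zero_iff_of_nonneg fun k _ => hj i k).1 h k (Finset.mem_univ _)
  have hsj : ∀ i k, s k = 0 → j i k = 0 := fun i k h =>
    (Finset.sum_eq_zero_iff_of_nonneg fun i _ => hj i k).1 h i (Finset.mem_univ _)
  have hrt : ∀ i, τ = 0 → r i = 0 := fun i h =>
    (Finset.sum_eq_zero_iff_of_nonneg fun i _ => hr0 i).1 h i (Finset.mem_univ _)
  -- The reference is the product of the marginals divided by `τ`, which has the same total mass `τ`
  -- as `j`.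
  have hG := sum_mul_log_sub_log_nonneg (ι := ι × κ) (fun p => j p.1 p.2)
    (fun p => r p.1 * s p.2 / τ) (fun p => hj _ _)
    (fun p => div_nonneg (mul_nonneg (hr0 _) (hs0 _)) hτ0)
    (by
      rintro ⟨i, k⟩ h
      simp only [div_eq_zero_iff, mul_eq_zero] at h
      rcases h with (h | h) | h
      · exact hrj i k h
      · exact hsj i k h
      · exact hrj i k (hrt i h))
    (by
      rw [Fintype.sum_prod_type, Fintype.sum_prod_type]
      simp only [← Finset.sum_div, ← Finset.mul_sum, hsτ, ← Finset.sum_mul, hrτ]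
      rw [← hτ, mul_self_div_self])
  have hterm : ∀ i k, j i k * (log (j i k) - log (r i * s k / τ)) =
      -negMulLog (j i k) - j i k * log (r i) - j i k * log (s k) + j i k * log τ := by
    intro i k
    rcases eq_or_ne (j i k) 0 with h | h
    · simp [h]
    have h1 : r i ≠ 0 := fun h' => h (hrj i k h')
    have h2 : s k ≠ 0 := fun h' => h (hsj i k h')
    have h3 : τ ≠ 0 := fun h' => h1 (hrt i h')
    rw [log_div (mul_ne_zero h1 h2) h3, log_mul h1 h2, negMulLog]
    ring
  rw [Fintype.sum_prod_type] at hG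
  simp only [hterm, Finset.sum_add_distrib, Finset.sum_sub_distrib, Finset.sum_neg_distrib] at hG
  have e1 : ∑ i, ∑ k, j i k * log (r i) = -∑ i, negMulLog (r i) := by
    rw [← Finset.sum_neg_distrib]
    exact Finset.sum_congr rfl fun i _ => by rw [← Finset.sum_mul, negMulLog]; ring
  have e2 : ∑ i, ∑ k, j i k * log (s k) = -∑ k, negMulLog (s k) := by
    rw [Finset.sum_comm, ← Finset.sum_neg_distrib]
    exact Finset.sum_congr rfl fun i _ => by rw [← Finset.sum_mul, negMulLog]; ring
  have e3 : ∑ i, ∑ k, j i k * log τ = -negMulLog τ := by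
    simp only [← Finset.sum_mul]
    rw [← hτ, negMulLog]; ring
  rw [e1, e2, e3] at hG
  linarith

theorem negMulLog_sum_le {ι : Type*} (s : Finset ι) (f : ι → ℝ) (hf : ∀ i ∈ s, 0 ≤ f i) :
    negMulLog (∑ i ∈ s, f i) ≤ ∑ i ∈ s, negMulLog (f i) := by
  have h : ∀ i ∈ s, f i * -log (∑ i ∈ s, f i) ≤ negMulLog (f i) := by
    intro i hi
    rcases (hf i hi).eq_or_lt with h0 | h0
    · simp [← h0]
    have := log_le_log h0 (Finset.single_le_sum hf hi)
    rw [negMulLog]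
    nlinarith
  calc negMulLog (∑ i ∈ s, f i) = ∑ i ∈ s, f i * -log (∑ i ∈ s, f i) := by
        rw [← Finset.sum_mul, negMulLog]; ring
    _ ≤ _ := Finset.sum_le_sum h

section weightInfo

variable {α β γ δ : Type*} [Fintype α] [Fintype β] [Fintype γ] [Fintype δ]

/-- The gap between the two sides is the mutual information between the index and the output, so it
is nonnegative. Together with homogeneity this is the concavity of mutual information in the input.
-/
theorem sum_weightInfo_le {ι : Type*} [Fintype ι] (w : ι → α → ℝ) (hw : ∀ i a, 0 ≤ w i a)
    {V : α → β → ℝ} (hV : IsKernel V) :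
    ∑ i, weightInfo (w i) V ≤ weightInfo (fun a => ∑ i, w i a) V := by
  have h := sum_negMulLog_add_le (fun i b => ∑ a, w i a * V a b)
    fun i b => Finset.sum_nonneg fun a _ => mul_nonneg (hw i a) (hV.nonneg a b)
  have e0 : ∀ u : α → ℝ, ∑ b, ∑ a, u a * V a b = ∑ a, u a := fun u => by
    rw [Finset.sum_comm]
    exact Finset.sum_congr rfl fun a _ => by rw [← Finset.mul_sum, hV.sum_eq_one, mul_one]
  simp only [e0] at h
  unfold weightInfo
  simp only [Finset.sum_sub_distrib, Finset.sum_mul]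
  have e1 : ∀ b, ∑ a, ∑ i, w i a * V a b = ∑ i, ∑ a, w i a * V a b := fun b => Finset.sum_comm
  have e2 : ∑ a, ∑ i, w i a = ∑ i, ∑ a, w i a := Finset.sum_comm
  have e3 : ∑ a, ∑ i, w i a * ∑ b, negMulLog (V a b) =
    ∑ i, ∑ a, w i a * ∑ b, negMulLog (V a b) := Finset.sum_comm
  simp only [e1, e2, e3]
  linarith

theorem weightInfo_zero (V : α → β → ℝ) : weightInfo (fun _ => 0) V = 0 := by
  simp [weightInfo]

theorem weightInfo_smul (c : ℝ) (w : α → ℝ) {V : α → β → ℝ} (hV : IsKernel V) :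
    weightInfo (fun a => c * w a) V = c * weightInfo w V := by
  have e0 : ∑ b, ∑ a, w a * V a b = ∑ a, w a := by
    rw [Finset.sum_comm]
    exact Finset.sum_congr rfl fun a _ => by rw [← Finset.mul_sum, hV.sum_eq_one, mul_one]
  unfold weightInfo
  simp only [mul_assoc, ← Finset.mul_sum, negMulLog_mul c, Finset.sum_add_distrib,
    ← Finset.sum_mul, e0]
  ring

theorem weightInfo_nonneg (w : α → ℝ) (hw : ∀ a, 0 ≤ w a) {V : α → β → ℝ} (hV : IsKernel V) :
    0 ≤ weightInfo w V := by
  have h := sum_negMulLog_add_le (fun a b => w a * V a b)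
    fun a b => mul_nonneg (hw a) (hV.nonneg a b)
  simp only [negMulLog_mul, Finset.sum_add_distrib, ← Finset.sum_mul, ← Finset.mul_sum,
    hV.sum_eq_one, mul_one, one_mul] at h
  unfold weightInfo
  linarith

/-- This is `H(B) ≤ H(A, B)`, by subadditivity of `negMulLog` at each output letter. It brings the
entropy of the source into the converse. -/
theorem weightInfo_le_sum_negMulLog (w : α → ℝ) (hw : ∀ a, 0 ≤ w a) {V : α → β → ℝ}
    (hV : IsKernel V) : weightInfo w V ≤ ∑ a, negMulLog (w a) - negMulLog (∑ a, w a) := by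
  have h : ∑ b, negMulLog (∑ a, w a * V a b) ≤ ∑ b, ∑ a, negMulLog (w a * V a b) :=
    Finset.sum_le_sum fun b _ => negMulLog_sum_le _ _ fun a _ => mul_nonneg (hw a) (hV.nonneg a b)
  rw [Finset.sum_comm] at h
  simp only [negMulLog_mul, Finset.sum_add_distrib, ← Finset.sum_mul, ← Finset.mul_sum,
    hV.sum_eq_one, one_mul] at h
  unfold weightInfo
  linarith

theorem weightInfo_reindex {α' β' : Type*} [Fintype α'] [Fintype β'] (e : α' ≃ α) (f : β' ≃ β)
    (w : α → ℝ) (V : α → β → ℝ) :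
    weightInfo (fun a => w (e a)) (fun a b => V (e a) (f b)) = weightInfo w V := by
  unfold weightInfo
  congr 1
  · congr 1
    · rw [← f.sum_comp]
      exact Finset.sum_congr rfl fun b _ => congrArg _ (e.sum_comp fun a => w a * V a (f b))
    · rw [← e.sum_comp]
      exact Finset.sum_congr rfl fun a _ =>
        congrArg _ (f.sum_comp fun b => negMulLog (V (e a) b))
  · rw [e.sum_comp]

/-- The product of two kernels. -/
def prodKernel (V₁ : α → β → ℝ) (V₂ : γ → δ → ℝ) : α × γ → β × δ → ℝ :=
  fun x y => V₁ x.1 y.1 * V₂ x.2 y.2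

theorem IsKernel.prod {α β γ δ : Type*} [Fintype β] [Fintype δ] {V₁ : α → β → ℝ}
    {V₂ : γ → δ → ℝ} (h₁ : IsKernel V₁) (h₂ : IsKernel V₂) :
    IsKernel (prodKernel V₁ V₂) where
  nonneg _ _ := mul_nonneg (h₁.nonneg _ _) (h₂.nonneg _ _)
  sum_eq_one x := by
    simp only [prodKernel, Fintype.sum_prod_type, ← Finset.mul_sum, h₂.sum_eq_one, mul_one,
      h₁.sum_eq_one]

/-- Chain rule. The slice at `b` is the joint weight of `b` and the second input; leaving it
unnormalized avoids conditioning on null events. -/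
theorem weightInfo_prodKernel {V₁ : α → β → ℝ} {V₂ : γ → δ → ℝ} (h₁ : IsKernel V₁)
    (h₂ : IsKernel V₂) (w : α × γ → ℝ) :
    weightInfo w (prodKernel V₁ V₂) = weightInfo (fun a => ∑ c, w (a, c)) V₁ +
      ∑ b, weightInfo (fun c => ∑ a, w (a, c) * V₁ a b) V₂ := by
  unfold weightInfo prodKernel
  simp only [Fintype.sum_prod_type, Finset.sum_sub_distrib]
  have e1 : ∀ b d, ∑ a, ∑ c, w (a, c) * (V₁ a b * V₂ c d) =
      ∑ c, (∑ a, w (a, c) * V₁ a b) * V₂ c d := fun b d => by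
    rw [Finset.sum_comm]
    exact Finset.sum_congr rfl fun c _ => by
      rw [Finset.sum_mul]; exact Finset.sum_congr rfl fun a _ => by ring
  have e2 : ∀ b, ∑ c, ∑ a, w (a, c) * V₁ a b = ∑ a, (∑ c, w (a, c)) * V₁ a b := fun b => by
    rw [Finset.sum_comm]
    exact Finset.sum_congr rfl fun a _ => by rw [Finset.sum_mul]
  have e3 : ∀ a c, ∑ b, ∑ d, negMulLog (V₁ a b * V₂ c d) =
      ∑ b, negMulLog (V₁ a b) + ∑ d, negMulLog (V₂ c d) := fun a c => by
    simp only [negMulLog_mul, Finset.sum_add_distrib, ← Finset.sum_mul, ← Finset.mul_sum,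
      h₁.sum_eq_one, h₂.sum_eq_one, one_mul]
  have e4 : ∑ b, ∑ c, (∑ a, w (a, c) * V₁ a b) * ∑ d, negMulLog (V₂ c d) =
      ∑ a, ∑ c, w (a, c) * ∑ d, negMulLog (V₂ c d) := by
    simp only [Finset.sum_mul]
    rw [Finset.sum_comm]
    rw [Finset.sum_comm (γ := α)]
    refine Finset.sum_congr rfl fun c _ => ?_
    rw [Finset.sum_comm]
    refine Finset.sum_congr rfl fun a _ => ?_
    simp only [← Finset.sum_mul, ← Finset.mul_sum, h₁.sum_eq_one, mul_one]
  simp only [e1, e3, e2, e4, mul_add, Finset.sum_add_distrib]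
  simp only [Finset.sum_mul]
  ring

/-- The chain rule with the second output revealed first. Comparing the two orders yields Csiszár's
identity. -/
theorem weightInfo_prodKernel' {V₁ : α → β → ℝ} {V₂ : γ → δ → ℝ} (h₁ : IsKernel V₁)
    (h₂ : IsKernel V₂) (w : α × γ → ℝ) :
    weightInfo w (prodKernel V₁ V₂) = weightInfo (fun c => ∑ a, w (a, c)) V₂ +
      ∑ d, weightInfo (fun a => ∑ c, w (a, c) * V₂ c d) V₁ := by
  rw [← weightInfo_prodKernel h₂ h₁ (fun x => w (x.2, x.1)),
    ← weightInfo_reindex (Equiv.prodComm γ α) (Equiv.prodComm δ β)]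
  congr 1
  funext x y
  simp [prodKernel, mul_comm]

end weightInfo

/-! ### Compactness of convex hulls -/

/-- By Carathéodory, `d = finrank + 1` points suffice for every convex combination, so the hull is a
continuous image of the product of a simplex with `d` copies of `K`. -/
theorem isCompact_convexHull_of_isCompact {E : Type*} [AddCommGroup E] [Module ℝ E]
    [TopologicalSpace E] [ContinuousAdd E] [ContinuousSMul ℝ E] [FiniteDimensional ℝ E]
    {K : Set E} (hK : IsCompact K) : IsCompact (convexHull ℝ K) := by
  rcases K.eq_empty_or_nonempty with rfl | ⟨x₀, hx₀⟩
  · simp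
  let d := Module.finrank ℝ E + 1
  have himg : convexHull ℝ K = (fun q : (Fin d → ℝ) × (Fin d → E) => ∑ i, q.1 i • q.2 i) ''
      (stdSimplex ℝ (Fin d) ×ˢ Set.univ.pi fun _ => K) := by
    apply Set.Subset.antisymm
    · intro x hx
      obtain ⟨ι, _, z, w, hz, hind, hw, hw1, rfl⟩ := eq_pos_convex_span_of_mem_convexHull hx
      have hcard : Fintype.card ι ≤ Fintype.card (Fin d) := by
        rw [Fintype.card_fin]
        exact hind.card_le_finrank_succ.trans (Nat.succ_le_succ (Submodule.finrank_le _))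
      obtain ⟨e⟩ := Function.Embedding.nonempty_of_card_le hcard
      classical
      -- Spare indices receive weight `0` and the default point `x₀` of `K`.
      refine ⟨(Function.extend e w 0, Function.extend e z fun _ => x₀), ⟨⟨?_, ?_⟩, ?_⟩, ?_⟩
      · intro i
        by_cases h : ∃ a, e a = i
        · obtain ⟨a, rfl⟩ := h
          simpa [e.injective.extend_apply] using (hw a).le
        · simp [Function.extend_apply' _ _ _ h]
      · rw [← hw1]
        symm
        refine Fintype.sum_of_injective e e.injective _ _ (fun i hi => ?_) (fun a => ?_)
        · exact Function.extend_apply' _ _ _ hi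
        · simp [e.injective.extend_apply]
      · intro i _
        by_cases h : ∃ a, e a = i
        · obtain ⟨a, rfl⟩ := h
          simpa [e.injective.extend_apply] using hz ⟨a, rfl⟩
        · simpa [Function.extend_apply' _ _ _ h] using hx₀
      · symm
        refine Fintype.sum_of_injective e e.injective _ _ (fun i hi => ?_) (fun a => ?_)
        · simp [Function.extend_apply' _ _ _ hi]
        · simp [e.injective.extend_apply]
    · rintro _ ⟨⟨w, z⟩, ⟨⟨hw, hw1⟩, hz⟩, rfl⟩
      exact mem_convexHull_of_exists_fintype w z hw hw1 (fun i => hz i trivial) rfl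
  rw [himg]
  refine ((isCompact_stdSimplex ℝ _).prod (isCompact_univ_pi fun _ => hK)).image ?_
  fun_prop

/-! ### The region of pairs of informations and its tensorization -/

section

variable {α β γ : Type*} [Fintype α] [Fintype β] [Fintype γ]

/-- The pairs of mutual informations that an input distribution achieves over two channels. -/
def infoRegion (V : α → β → ℝ) (V' : α → γ → ℝ) : Set (ℝ × ℝ) :=
  (fun p : α → ℝ => (weightInfo p V, weightInfo p V')) '' stdSimplex ℝ α

theorem isCompact_infoRegion (V : α → β → ℝ) (V' : α → γ → ℝ) : IsCompact (infoRegion V V') := by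
  refine (isCompact_stdSimplex ℝ α).image ?_
  unfold weightInfo
  have := continuous_negMulLog
  fun_prop

theorem nonempty_infoRegion [Nonempty α] (V : α → β → ℝ) (V' : α → γ → ℝ) :
    (infoRegion V V').Nonempty := by
  classical
  exact ⟨_, _, single_mem_stdSimplex ℝ (Classical.arbitrary α), rfl⟩

/-- For convex `C` and `s, t ≥ 0` one has `s • C + t • C = (s + t) • C`. Nonemptiness serves the
empty sum, where `0 • C` must contain `0`. -/
theorem sum_mem_sum_smul {E ι : Type*} [AddCommGroup E] [Module ℝ E] {C : Set E}
    (hC : Convex ℝ C) (hne : C.Nonempty) (s : Finset ι) (t : ι → ℝ) (ht : ∀ i, 0 ≤ t i)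
    (v : ι → E) (hv : ∀ i, v i ∈ t i • C) : ∑ i ∈ s, v i ∈ (∑ i ∈ s, t i) • C := by
  classical
  induction s using Finset.induction_on with
  | empty => simp [Set.zero_smul_set hne]
  | insert i s hi ih =>
    rw [Finset.sum_insert hi, Finset.sum_insert hi,
      hC.add_smul (ht i) (Finset.sum_nonneg fun j _ => ht j)]
    exact Set.add_mem_add (hv i) ih

/-- `SingleLetter C t V V'`: for each input weight of the channels `V` and `V'`, there is a pair in
`t` copies of `C` with the same difference as the pair of mutual informations and a second
component that is not larger. -/
def SingleLetter (C : Set (ℝ × ℝ)) (t : ℝ) (V : α → β → ℝ) (V' : α → γ → ℝ) : Prop :=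
  ∀ w : α → ℝ, (∀ a, 0 ≤ w a) → ∃ v ∈ (t * ∑ a, w a) • C,
    weightInfo w V - weightInfo w V' = v.1 - v.2 ∧ v.2 ≤ weightInfo w V'

theorem singleLetter_convexHull [Nonempty α] {V : α → β → ℝ} {V' : α → γ → ℝ} (hV : IsKernel V)
    (hV' : IsKernel V') : SingleLetter (convexHull ℝ (infoRegion V V')) 1 V V' := by
  intro w hw
  refine ⟨(weightInfo w V, weightInfo w V'), ?_, rfl, le_rfl⟩
  rw [one_mul]
  have h0 : 0 ≤ ∑ a, w a := Finset.sum_nonneg fun a _ => hw a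
  rcases h0.eq_or_lt with h | h
  · have hz : w = fun _ => 0 := funext fun a =>
      (Finset.sum_eq_zero_iff_of_nonneg fun a _ => hw a).1 h.symm a (Finset.mem_univ _)
    rw [← h, Set.zero_smul_set ((nonempty_infoRegion V V').mono (subset_convexHull ℝ _)), hz,
      weightInfo_zero, weightInfo_zero]
    rfl
  · refine ⟨_, subset_convexHull ℝ _ ⟨fun a => (∑ a, w a)⁻¹ * w a, ⟨fun a => ?_, ?_⟩, rfl⟩, ?_⟩
    · exact mul_nonneg (inv_nonneg.2 h0) (hw a)
    · rw [← Finset.mul_sum, inv_mul_cancel₀ h.ne']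
    · simp only [weightInfo_smul _ _ hV, weightInfo_smul _ _ hV', Prod.smul_mk, smul_eq_mul,
        mul_inv_cancel_left₀ h.ne']

/-- Let the inputs be `A, C`, with outputs `Y₁, Z₁` and `Y₂, Z₂`. Csiszár's identity says that
`I(AC;Y₁Y₂) - I(AC;Z₁Z₂)` equals `[I(A;Y₁|Z₂) - I(A;Z₁|Z₂)] + [I(C;Y₂|Y₁) - I(C;Z₂|Y₁)]`. The
hypothesis for the first use is applied to each slice `Z₂ = d`, the one for the second use to each
slice `Y₁ = b`. The `Z`-terms sum to at most `I(A;Z₁|Z₂) + I(C;Z₂) = I(AC;Z₁Z₂)`. -/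
theorem SingleLetter.prod {α' β' γ' : Type*} [Fintype α'] [Fintype β'] [Fintype γ']
    {C : Set (ℝ × ℝ)} (hC : Convex ℝ C) (hne : C.Nonempty) {s t : ℝ} (hs : 0 ≤ s) (ht : 0 ≤ t)
    {V : α → β → ℝ} {V' : α → γ → ℝ} {U : α' → β' → ℝ} {U' : α' → γ' → ℝ}
    (hV : IsKernel V) (hV' : IsKernel V') (hU : IsKernel U) (hU' : IsKernel U')
    (h : SingleLetter C s V V') (h' : SingleLetter C t U U') :
    SingleLetter C (s + t) (prodKernel V U) (prodKernel V' U') := by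
  intro w hw
  have hwb : ∀ b c, 0 ≤ ∑ a, w (a, c) * V a b := fun b c =>
    Finset.sum_nonneg fun a _ => mul_nonneg (hw _) (hV.nonneg _ _)
  have hwd : ∀ d a, 0 ≤ ∑ c, w (a, c) * U' c d := fun b c =>
    Finset.sum_nonneg fun a _ => mul_nonneg (hw _) (hU'.nonneg _ _)
  choose x hx hx1 hx2 using fun b => h' (fun c => ∑ a, w (a, c) * V a b) (hwb b)
  choose y hy hy1 hy2 using fun d => h (fun a => ∑ c, w (a, c) * U' c d) (hwd d)
  have hmassb : ∀ c, ∑ b, ∑ a, w (a, c) * V a b = ∑ a, w (a, c) := fun c => by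
    rw [Finset.sum_comm]
    simp only [← Finset.mul_sum, hV.sum_eq_one, mul_one]
  have hmassd : ∀ a, ∑ d, ∑ c, w (a, c) * U' c d = ∑ c, w (a, c) := fun c => by
    rw [Finset.sum_comm]
    simp only [← Finset.mul_sum, hU'.sum_eq_one, mul_one]
  have hτ : ∑ p, w p = ∑ a, ∑ c, w (a, c) := Fintype.sum_prod_type w
  have mx := sum_mem_sum_smul hC hne Finset.univ _
    (fun b => mul_nonneg ht (Finset.sum_nonneg fun c _ => hwb b c)) x hx
  have my := sum_mem_sum_smul hC hne Finset.univ _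
    (fun d => mul_nonneg hs (Finset.sum_nonneg fun a _ => hwd d a)) y hy
  have hcx : ∑ b, ∑ c, ∑ a, w (a, c) * V a b = ∑ p, w p := by
    rw [Finset.sum_comm, hτ, Finset.sum_comm (γ := α)]
    exact Finset.sum_congr rfl fun c _ => hmassb c
  have hcy : ∑ d, ∑ a, ∑ c, w (a, c) * U' c d = ∑ p, w p := by
    rw [Finset.sum_comm, hτ]
    exact Finset.sum_congr rfl fun c _ => hmassd c
  rw [← Finset.mul_sum, hcx] at mx
  rw [← Finset.mul_sum, hcy] at my
  have h0 : 0 ≤ ∑ p, w p := Finset.sum_nonneg fun p _ => hw p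
  -- `e3` and `e4` expand `I(AC;Y₁Z₂)` in both orders; equating them trades `I(A;Y₁) - I(C;Z₂)` for
  -- `I(A;Y₁|Z₂) - I(C;Z₂|Y₁)`.
  have e1 := weightInfo_prodKernel hV hU w
  have e2 := weightInfo_prodKernel' hV' hU' w
  have e3 := weightInfo_prodKernel hV hU' w
  have e4 := weightInfo_prodKernel' hV hU' w
  -- `I(C;Z₂|Y₁) ≤ I(C;Z₂)`, since `Y₁ - C - Z₂` is a Markov chain.
  have hle : ∑ b, weightInfo (fun c => ∑ a, w (a, c) * V a b) U' ≤
      weightInfo (fun c => ∑ a, w (a, c)) U' := by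
    have := sum_weightInfo_le (fun b c => ∑ a, w (a, c) * V a b) hwb hU'
    simpa only [hmassb] using this
  refine ⟨∑ d, y d + ∑ b, x b, ?_, ?_, ?_⟩
  · rw [add_mul, hC.add_smul (mul_nonneg hs h0) (mul_nonneg ht h0)]
    exact Set.add_mem_add my mx
  · have s1 := Finset.sum_congr rfl fun b (_ : b ∈ Finset.univ) => hx1 b
    have s2 := Finset.sum_congr rfl fun b (_ : b ∈ Finset.univ) => hy1 b
    simp only [Finset.sum_sub_distrib] at s1 s2
    simp only [Prod.fst_add, Prod.snd_add, Prod.fst_sum, Prod.snd_sum]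
    linarith
  · have s1 := Finset.sum_le_sum fun b (_ : b ∈ Finset.univ) => hx2 b
    have s2 := Finset.sum_le_sum fun b (_ : b ∈ Finset.univ) => hy2 b
    simp only [Prod.snd_add, Prod.snd_sum]
    linarith

theorem SingleLetter.reindex {α' β' γ' : Type*} [Fintype α'] [Fintype β'] [Fintype γ']
    {C : Set (ℝ × ℝ)} {t : ℝ} {V : α → β → ℝ} {V' : α → γ → ℝ} (h : SingleLetter C t V V')
    (e : α' ≃ α) (f : β' ≃ β) (g : γ' ≃ γ) :
    SingleLetter C t (fun a b => V (e a) (f b)) (fun a c => V' (e a) (g c)) := by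
  intro w hw
  obtain ⟨v, hv, h1, h2⟩ := h (fun a => w (e.symm a)) fun a => hw _
  rw [e.symm.sum_comp] at hv
  rw [← weightInfo_reindex e f, ← weightInfo_reindex e g] at h1
  rw [← weightInfo_reindex e g] at h2
  simp only [Equiv.symm_apply_apply] at h1 h2
  exact ⟨v, hv, h1, h2⟩

/-- `n` memoryless uses of a channel. -/
def powKernel (n : ℕ) (V : α → β → ℝ) : (Fin n → α) → (Fin n → β) → ℝ :=
  fun x y => ∏ i, V (x i) (y i)

omit [Fintype α] in
theorem IsKernel.pow {V : α → β → ℝ} (hV : IsKernel V) (n : ℕ) : IsKernel (powKernel n V) where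
  nonneg _ _ := Finset.prod_nonneg fun _ _ => hV.nonneg _ _
  sum_eq_one x := by
    classical
    simp only [powKernel]
    rw [← Fintype.prod_sum fun i b => V (x i) b]
    simp [hV.sum_eq_one]

theorem singleLetter_powKernel [Nonempty α] {V : α → β → ℝ} {V' : α → γ → ℝ} (hV : IsKernel V)
    (hV' : IsKernel V') (n : ℕ) :
    SingleLetter (convexHull ℝ (infoRegion V V')) n (powKernel n V) (powKernel n V') := by
  have hne := (nonempty_infoRegion V V').mono (subset_convexHull ℝ _)
  induction n with
  | zero =>
    intro w hw
    refine ⟨0, by simp [Set.zero_smul_set hne], ?_, ?_⟩ <;> simp [weightInfo, powKernel]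
  | succ n ih =>
    have h := (SingleLetter.prod (convex_convexHull ℝ _) hne zero_le_one n.cast_nonneg hV hV'
      (hV.pow n) (hV'.pow n) (singleLetter_convexHull hV hV') ih).reindex
      (Fin.consEquiv fun _ : Fin (n + 1) => α).symm (Fin.consEquiv fun _ : Fin (n + 1) => β).symm
      (Fin.consEquiv fun _ : Fin (n + 1) => γ).symm
    rw [Nat.cast_add_one, add_comm (n : ℝ)]
    convert h using 3 <;> simp [powKernel, prodKernel, Fin.prod_univ_succ, Fin.consEquiv, Fin.tail]

end

/-! ### Informations of probability mass functions in terms of weights -/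

theorem PMF_sum_toReal {α : Type*} [Fintype α] (p : PMF α) : ∑ a, (p a).toReal = 1 := by
  rw [← ENNReal.toReal_sum fun a _ => p.apply_ne_top a, ← tsum_fintype (L := .unconditional _),
    p.tsum_coe, ENNReal.toReal_one]

open Classical in
theorem toReal_map_apply {α β : Type*} [Fintype α] (p : PMF α) (f : α → β) (b : β) :
    (p.map f b).toReal = ∑ a, if f a = b then (p a).toReal else 0 := by
  rw [PMF.map_apply, tsum_fintype, ENNReal.toReal_sum]
  · refine Finset.sum_congr rfl fun a _ => ?_
    by_cases h : f a = b
    · simp [h]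
    · simp [h, Ne.symm h]
  · intro a _
    split_ifs
    · exact p.apply_ne_top a
    · simp

theorem toReal_bind_apply {α β : Type*} [Fintype α] (p : PMF α) (f : α → PMF β) (b : β) :
    (p.bind f b).toReal = ∑ a, (p a).toReal * (f a b).toReal := by
  rw [PMF.bind_apply, tsum_fintype, ENNReal.toReal_sum]
  · simp
  · exact fun a _ => ENNReal.mul_ne_top (p.apply_ne_top a) ((f a).apply_ne_top b)

theorem entropy_eq {α : Type*} [Fintype α] (p : PMF α) :
    entropy p = (∑ a, negMulLog (p a).toReal) / log 2 := by
  rw [entropy, Finset.sum_div]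

/-- The channel from `X` to the function `g` of the output of `W`. -/
noncomputable def out {X O O' : Type*} (W : X → PMF O) (g : O → O') : X → O' → ℝ :=
  fun x o => ((W x).map g o).toReal

theorem isKernel_out {X O O' : Type*} [Fintype O'] (W : X → PMF O) (g : O → O') :
    IsKernel (out W g) where
  nonneg _ _ := ENNReal.toReal_nonneg
  sum_eq_one _ := PMF_sum_toReal _

section

variable {Ω α β γ : Type*} [Fintype α] [Fintype β] [Fintype γ]

/-- The factorization `h` says that `w` is the joint weight of `C` and `A`, and that `B` depends on
`C` only through `A`. -/
theorem condMutualInfo_eq_sum_weightInfo (μ : PMF Ω) (A : Ω → α) (B : Ω → β) (C : Ω → γ)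
    (w : γ → α → ℝ) {V : α → β → ℝ} (hV : IsKernel V)
    (h : ∀ a b c, (μ.map (fun ω => (A ω, B ω, C ω)) (a, b, c)).toReal = w c a * V a b) :
    condMutualInfo μ A B C = (∑ c, weightInfo (w c) V) / log 2 := by
  classical
  have hAC : ∀ a c, (μ.map (fun ω => (A ω, C ω)) (a, c)).toReal = w c a := by
    intro a c
    have : (fun ω => (A ω, C ω)) = (fun p : α × β × γ => (p.1, p.2.2)) ∘
      fun ω => (A ω, B ω, C ω) := rfl
    rw [this, ← PMF.map_comp, toReal_map_apply]
    simp only [Fintype.sum_prod_type, h, Prod.mk.injEq, ite_and, Finset.sum_ite_irrel,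
      Finset.sum_const_zero, Finset.sum_ite_eq', Finset.mem_univ, if_true, ← Finset.mul_sum,
      hV.sum_eq_one, mul_one]
  have hBC : ∀ b c, (μ.map (fun ω => (B ω, C ω)) (b, c)).toReal = ∑ a, w c a * V a b := by
    intro b c
    have : (fun ω => (B ω, C ω)) = (fun p : α × β × γ => p.2) ∘
      fun ω => (A ω, B ω, C ω) := rfl
    rw [this, ← PMF.map_comp, toReal_map_apply]
    simp only [Fintype.sum_prod_type, h, Finset.sum_ite_eq', Finset.mem_univ, if_true]
  have hC : ∀ c, (μ.map C c).toReal = ∑ a, w c a := by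
    intro c
    have : C = (fun p : α × γ => p.2) ∘ fun ω => (A ω, C ω) := rfl
    rw [this, ← PMF.map_comp, toReal_map_apply]
    simp only [Fintype.sum_prod_type, hAC, Finset.sum_ite_eq', Finset.mem_univ, if_true]
  unfold condMutualInfo H
  simp only [entropy_eq, Fintype.sum_prod_type, h, hAC, hBC, hC]
  have e1 : ∑ a, ∑ b, ∑ c, negMulLog (w c a * V a b) =
      ∑ a, ∑ c, negMulLog (w c a) + ∑ c, ∑ a, w c a * ∑ b, negMulLog (V a b) := by
    rw [Finset.sum_comm (γ := γ), ← Finset.sum_add_distrib]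
    refine Finset.sum_congr rfl fun a _ => ?_
    rw [Finset.sum_comm, ← Finset.sum_add_distrib]
    refine Finset.sum_congr rfl fun c _ => ?_
    simp only [negMulLog_mul, Finset.sum_add_distrib, ← Finset.sum_mul, ← Finset.mul_sum,
      hV.sum_eq_one, one_mul]
  have e2 : ∑ b, ∑ c, negMulLog (∑ a, w c a * V a b) = ∑ c, ∑ b, negMulLog (∑ a, w c a * V a b) :=
    Finset.sum_comm
  rw [e1, e2]
  unfold weightInfo
  simp only [Finset.sum_sub_distrib]
  ring

omit [Fintype γ] in
theorem H_comp_equiv (μ : PMF Ω) (A : Ω → α) (e : α ≃ β) :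
    H μ (fun ω => e (A ω)) = H μ A := by
  unfold H
  rw [entropy_eq, entropy_eq, ← e.sum_comp]
  congr 1
  refine Finset.sum_congr rfl fun a _ => ?_
  simp only [PMF.map_apply]
  exact congrArg (fun x => negMulLog (ENNReal.toReal x))
    (tsum_congr fun ω => by by_cases h : a = A ω <;> simp [h])

omit [Fintype γ] in
theorem mutualInfo_eq_weightInfo (μ : PMF Ω) (A : Ω → α) (B : Ω → β)
    (w : α → ℝ) {V : α → β → ℝ} (hV : IsKernel V)
    (h : ∀ a b, (μ.map (fun ω => (A ω, B ω)) (a, b)).toReal = w a * V a b) :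
    mutualInfo μ A B = weightInfo w V / log 2 := by
  have hc := condMutualInfo_eq_sum_weightInfo μ A B (fun _ => ()) (fun _ => w) hV (by
    rintro a b ⟨⟩
    classical
    rw [← h a b]
    have : (fun ω => (A ω, B ω, ())) = (fun p : α × β => (p.1, p.2, ())) ∘
      fun ω => (A ω, B ω) := rfl
    rw [this, ← PMF.map_comp, toReal_map_apply]
    simp [Fintype.sum_prod_type, ite_and])
  have e0 : H μ (fun _ => ()) = 0 := by
    unfold H
    have := PMF_sum_toReal (μ.map fun _ => ())
    simp only [Finset.univ_unique, Finset.sum_singleton] at this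
    rw [entropy_eq]
    simp only [Finset.univ_unique, Finset.sum_singleton, this]
    simp
  unfold condMutualInfo at hc
  have e1 := H_comp_equiv μ A (Equiv.prodPUnit α).symm
  have e2 := H_comp_equiv μ B (Equiv.prodPUnit β).symm
  have e3 := H_comp_equiv μ (fun ω => (A ω, B ω))
    (Equiv.prodCongr (Equiv.refl α) (Equiv.prodPUnit β).symm)
  simp only [Equiv.prodPUnit_symm_apply, Equiv.prodCongr_apply, Prod.map, Equiv.refl_apply]
    at e1 e2 e3
  rw [e1, e2, e3, e0] at hc
  unfold mutualInfo
  simpa using hc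

end

theorem toReal_map_prod_mk_apply {α β γ : Type*} [DecidableEq α] (p : PMF β) (f : β → γ)
    (a a' : α) (c : γ) :
    (p.map (fun b => (a, f b)) (a', c)).toReal = if a = a' then (p.map f c).toReal else 0 := by
  classical
  rw [PMF.map_apply, PMF.map_apply]
  split_ifs with h
  · subst h; simp
  · simp [Ne.symm h]

theorem lessCapable_iff {X Y Z : Type*} [Fintype X] [Fintype Y] [Fintype Z]
    (W : X → PMF (Y × Z)) : LessCapable W ↔ ∀ p : PMF X,
      weightInfo (fun x => (p x).toReal) (out W Prod.snd) ≤
        weightInfo (fun x => (p x).toReal) (out W Prod.fst) := by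
  classical
  refine forall_congr' fun p => ?_
  have h2 : 0 < log 2 := log_pos one_lt_two
  dsimp only
  rw [mutualInfo_eq_weightInfo _ _ _ (fun x => (p x).toReal) (isKernel_out W Prod.snd),
    mutualInfo_eq_weightInfo _ _ _ (fun x => (p x).toReal) (isKernel_out W Prod.fst),
    div_le_div_iff_of_pos_right h2]
  all_goals
    intro a b
    rw [PMF.map_bind, toReal_bind_apply]
    simp only [PMF.map_comp, Function.comp_def, out]
    simp only [toReal_map_prod_mk_apply (W _)]
    simp

/-- The variable `V` is summed out here: only the law `(pV u).bind pX` of `X` given `U = u` remains.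
-/
theorem condMutualInfo_auxLaw {k l : ℕ} {X Y Z O : Type*} [Fintype X] [Fintype Y] [Fintype Z]
    [Fintype O] (pU : PMF (Fin k)) (pV : Fin k → PMF (Fin l)) (pX : Fin l → PMF X)
    (W : X → PMF (Y × Z)) (g : Y × Z → O) :
    condMutualInfo (auxLaw pU pV pX W) (fun ω => ω.2.2.1) (fun ω => g ω.2.2.2) (fun ω => ω.1) =
      (∑ u, weightInfo (fun x => (pU u).toReal * (((pV u).bind pX) x).toReal) (out W g)) /
        log 2 := by
  classical
  refine condMutualInfo_eq_sum_weightInfo _ _ _ _ (fun _ _ => _) (isKernel_out W g) ?_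
  intro x o u
  unfold auxLaw
  have h1 : ∀ (x' : X) (u' : Fin k), ((W x').map (fun yz => (x', g yz, u')) (x, o, u)).toReal =
      if x' = x then if u' = u then out W g x o else 0 else 0 := by
    intro x' u'
    rw [toReal_map_prod_mk_apply (W x') (fun yz => (g yz, u')) x' x (o, u)]
    refine if_ctx_congr Iff.rfl (fun h => ?_) fun _ => rfl
    subst h
    have : (fun yz => (g yz, u')) = Prod.swap ∘ fun yz => (u', g yz) := rfl
    rw [this, ← PMF.map_comp]
    have h2 : ((W x').map (fun yz => (u', g yz))).map Prod.swap (o, u) =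
        (W x').map (fun yz => (u', g yz)) (u, o) := by
      rw [PMF.map_apply, tsum_eq_single (u, o)]
      · simp
      · rintro ⟨a, b⟩ hab
        rw [if_neg]
        intro h
        apply hab
        simp only [Prod.swap_prod_mk, Prod.mk.injEq] at h ⊢
        exact ⟨h.2.symm, h.1.symm⟩
    rw [h2, toReal_map_prod_mk_apply]
    rfl
  simp only [PMF.map_bind, toReal_bind_apply, PMF.map_comp, Function.comp_def]
  simp only [h1]
  simp only [mul_ite, mul_zero, Finset.sum_ite_eq', Finset.mem_univ, if_true, Finset.mul_sum,
    Finset.sum_mul, Finset.sum_ite_irrel, Finset.sum_const_zero]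
  refine Finset.sum_congr rfl fun v _ => by ring

/-! ### Product distributions and the entropy of their images -/

theorem tsum_prod_eq_prod_tsum {α : Type*} : ∀ (n : ℕ) (f : Fin n → α → ℝ≥0∞),
    ∑' x : Fin n → α, ∏ i, f i (x i) = ∏ i, ∑' a, f i a
  | 0, f => by simp
  | n + 1, f => by
    rw [← (Fin.consEquiv (fun _ : Fin (n + 1) => α)).tsum_eq, ENNReal.tsum_prod']
    simp only [Fin.prod_univ_succ, Fin.consEquiv_apply, Fin.cons_zero, Fin.cons_succ,
      ENNReal.tsum_mul_left, tsum_prod_eq_prod_tsum n (fun i => f i.succ), ENNReal.tsum_mul_right]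

theorem productPMF_apply {α : Type*} {n : ℕ} (p : Fin n → PMF α) (x : Fin n → α) :
    productPMF p x = ∏ i, p i (x i) := rfl

theorem productPMF_map {α β : Type*} {n : ℕ} (p : Fin n → PMF α) (f : Fin n → α → β) :
    (productPMF p).map (fun x i => f i (x i)) = productPMF fun i => (p i).map (f i) := by
  classical
  ext y
  simp only [PMF.map_apply, productPMF_apply, ← tsum_prod_eq_prod_tsum]
  refine tsum_congr fun x => ?_
  rw [Finset.prod_ite_zero]
  simp [funext_iff]

/-- The information content, in bits, of an event of probability `x`. -/
noncomputable def surprisal (x : ℝ≥0∞) : ℝ≥0∞ := ENNReal.ofReal (-log x.toReal / log 2)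

theorem discreteEntropy_eq_tsum {α : Type*} (p : PMF α) :
    discreteEntropy p = ∑' a, p a * surprisal (p a) := by
  refine tsum_congr fun a => ?_
  conv_rhs => rw [← ENNReal.ofReal_toReal (p.apply_ne_top a)]
  rw [surprisal, ← ENNReal.ofReal_mul ENNReal.toReal_nonneg,
    ENNReal.toReal_ofReal ENNReal.toReal_nonneg, negMulLog]
  congr 1
  ring

theorem surprisal_anti {x y : ℝ≥0∞} (hx : x ≠ 0) (hy : y ≠ ∞) (h : x ≤ y) :
    surprisal y ≤ surprisal x := by
  refine ENNReal.ofReal_le_ofReal (div_le_div_of_nonneg_right (neg_le_neg ?_)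
    (log_pos one_lt_two).le)
  exact log_le_log (ENNReal.toReal_pos hx (ne_top_of_le_ne_top hy h)) (ENNReal.toReal_mono hy h)

/-- The image of a point is at least as likely as the point, hence no more surprising. Working with
surprisals in `[0, ∞]` covers infinite entropy. -/
theorem discreteEntropy_map_le {α β : Type*} (p : PMF α) (f : α → β) :
    discreteEntropy (p.map f) ≤ discreteEntropy p := by
  classical
  have hle : ∀ a, p a ≤ p.map f (f a) := fun a => by
    rw [PMF.map_apply]
    exact (by simp : p a = if f a = f a then p a else 0).trans_le
      (ENNReal.le_tsum (f := fun a' => if f a = f a' then p a' else 0) a)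
  calc discreteEntropy (p.map f)
      = ∑' b, ∑' a, (if b = f a then p a * surprisal (p.map f b) else 0) := by
        rw [discreteEntropy_eq_tsum]
        refine tsum_congr fun b => ?_
        conv_lhs => rw [PMF.map_apply, ← ENNReal.tsum_mul_right]
        refine tsum_congr fun a => ?_
        rw [← PMF.map_apply]
        split_ifs <;> simp
    _ = ∑' a, p a * surprisal (p.map f (f a)) := by
        rw [ENNReal.tsum_comm]
        refine tsum_congr fun a => ?_
        rw [tsum_eq_single (f a)]
        · simp
        · intro b hb; simp [hb]
    _ ≤ ∑' a, p a * surprisal (p a) := by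
        refine ENNReal.tsum_le_tsum fun a => ?_
        rcases eq_or_ne (p a) 0 with h | h
        · simp [h]
        · exact mul_le_mul_right (surprisal_anti h (PMF.apply_ne_top _ _) (hle a)) _
    _ = _ := (discreteEntropy_eq_tsum p).symm

theorem surprisal_mul_le {x y : ℝ≥0∞} (hx : x ≠ 0) (hx' : x ≠ ∞) (hy : y ≠ 0) (hy' : y ≠ ∞) :
    surprisal (x * y) ≤ surprisal x + surprisal y := by
  unfold surprisal
  rw [ENNReal.toReal_mul, log_mul (ENNReal.toReal_pos hx hx').ne' (ENNReal.toReal_pos hy hy').ne',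
    neg_add, add_div]
  exact ENNReal.ofReal_add_le

theorem discreteEntropy_productPMF_le {α : Type*} (p : PMF α) (n : ℕ) :
    discreteEntropy (productPMF fun _ : Fin n => p) ≤ n * discreteEntropy p := by
  induction n with
  | zero => simp [discreteEntropy, productPMF_apply]
  | succ n ih =>
    rw [discreteEntropy_eq_tsum, ← (Fin.consEquiv (fun _ : Fin (n + 1) => α)).tsum_eq,
      ENNReal.tsum_prod']
    set q := productPMF fun _ : Fin n => p with hq
    have happ : ∀ a (x : Fin n → α), (productPMF fun _ : Fin (n + 1) => p)
        (Fin.consEquiv (fun _ : Fin (n + 1) => α) (a, x)) = p a * q x := fun a x => by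
      simp [productPMF_apply, Fin.prod_univ_succ, Fin.consEquiv_apply, hq]
    simp only [happ]
    calc ∑' a, ∑' x, p a * q x * surprisal (p a * q x)
        ≤ ∑' a, ∑' x, (p a * surprisal (p a) * q x + p a * (q x * surprisal (q x))) := by
          refine ENNReal.tsum_le_tsum fun a => ENNReal.tsum_le_tsum fun x => ?_
          rcases eq_or_ne (p a) 0 with h | h
          · simp [h]
          rcases eq_or_ne (q x) 0 with h' | h'
          · simp [h']
          calc p a * q x * surprisal (p a * q x)
              ≤ p a * q x * (surprisal (p a) + surprisal (q x)) :=
                mul_le_mul_right (surprisal_mul_le h (PMF.apply_ne_top _ _) h'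
                  (PMF.apply_ne_top _ _)) _
            _ = _ := by ring
      _ = discreteEntropy p + discreteEntropy q := by
          simp only [ENNReal.tsum_add, ENNReal.tsum_mul_left, ENNReal.tsum_mul_right, PMF.tsum_coe,
            mul_one, one_mul, discreteEntropy_eq_tsum]
      _ ≤ _ := by
          push_cast
          rw [add_mul, one_mul, add_comm]
          exact add_le_add_left ih _

/-! ### The law of a code in terms of weights -/

section code

variable {S X Y Z : Type*} {M n : ℕ}

/-- The law of the codeword of the message `m`. -/
noncomputable def Code.inputLaw (C : Code S X Y M n) (pS : PMF S) (m : Fin M) : PMF (Fin n → X) :=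
  (productPMF fun _ : Fin n => pS).map (C.enc m)

/-- The channel from the message to the `n` outputs of the channel `V`. -/
noncomputable def Code.kernel [Fintype X] {O : Type*} (C : Code S X Y M n) (pS : PMF S)
    (V : X → O → ℝ) (m : Fin M) (o : Fin n → O) : ℝ :=
  ∑ x, (C.inputLaw pS m x).toReal * powKernel n V x o

theorem sum_mul_kernel {α β : Type*} [Fintype α] [Fintype β] {w : α → ℝ} {V : α → β → ℝ}
    (hV : IsKernel V) : ∑ b, ∑ a, w a * V a b = ∑ a, w a := by
  rw [Finset.sum_comm]
  exact Finset.sum_congr rfl fun a _ => by rw [← Finset.mul_sum, hV.sum_eq_one, mul_one]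

theorem Code.isKernel_kernel [Fintype X] {O : Type*} [Fintype O] (C : Code S X Y M n) (pS : PMF S)
    {V : X → O → ℝ} (hV : IsKernel V) : IsKernel (C.kernel pS V) where
  nonneg _ _ := Finset.sum_nonneg fun _ _ =>
    mul_nonneg ENNReal.toReal_nonneg ((hV.pow n).nonneg _ _)
  sum_eq_one m := by
    unfold Code.kernel
    rw [sum_mul_kernel (hV.pow n), PMF_sum_toReal]

theorem Code.law_map_apply [Fintype X] {O : Type*} [NeZero M] (C : Code S X Y M n)
    (W : X → PMF (Y × Z)) (pS : PMF S) (g : Y × Z → O) (m : Fin M) (o : Fin n → O) :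
    ((C.law W pS).map (fun ω => (ω.1, fun i => g (ω.2 i))) (m, o)).toReal =
      (M : ℝ)⁻¹ * C.kernel pS (out W g) m o := by
  classical
  unfold Code.law
  have h1 : ∀ m : Fin M, ((productPMF fun _ : Fin n => pS).bind fun s =>
      (productPMF fun i => W (C.enc m s i)).map fun yz => (m, yz)) =
      (C.inputLaw pS m).bind fun x => (productPMF fun i => W (x i)).map fun yz => (m, yz) := by
    intro m
    rw [Code.inputLaw, PMF.bind_map]
    rfl
  simp only [h1, PMF.map_bind, toReal_bind_apply, PMF.map_comp, Function.comp_def]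
  have h2 : ∀ (x : Fin n → X) (m' : Fin M),
      ((productPMF fun i => W (x i)).map (fun yz => (m', fun i => g (yz i))) (m, o)).toReal =
      if m' = m then powKernel n (out W g) x o else 0 := by
    intro x m'
    rw [toReal_map_prod_mk_apply (productPMF fun i => W (x i)) (fun yz i => g (yz i)) m' m o,
      productPMF_map (fun i => W (x i)) fun _ => g, productPMF_apply, ENNReal.toReal_prod]
    rfl
  simp only [h2, mul_ite, mul_zero, Finset.sum_ite_irrel, Finset.sum_const_zero,
    Finset.sum_ite_eq', Finset.mem_univ, if_true, PMF.uniformOfFintype_apply, Code.kernel,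
    Fintype.card_fin, ENNReal.toReal_inv, ENNReal.toReal_natCast]

theorem Code.leakage_eq [Fintype X] [Fintype Y] [Fintype Z] [NeZero M] (C : Code S X Y M n)
    (W : X → PMF (Y × Z)) (pS : PMF S) :
    C.leakage W pS =
      weightInfo (fun _ => (M : ℝ)⁻¹) (C.kernel pS (out W Prod.snd)) / log 2 :=
  mutualInfo_eq_weightInfo _ _ _ _ (C.isKernel_kernel pS (isKernel_out W _))
    fun m o => C.law_map_apply W pS Prod.snd m o

open Classical in
theorem Code.errorProb_eq [Fintype X] [Fintype Y] [NeZero M] (C : Code S X Y M n)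
    (W : X → PMF (Y × Z)) (pS : PMF S) :
    C.errorProb W pS = ∑ m, (M : ℝ)⁻¹ * ∑ y, C.kernel pS (out W Prod.fst) m y *
      if C.dec y = some m then 0 else 1 := by
  have hset : {ω : Fin M × (Fin n → Y × Z) | C.dec (fun i => (ω.2 i).1) ≠ some ω.1} =
    (fun ω => (ω.1, fun i => (ω.2 i).1)) ⁻¹' {ω : Fin M × (Fin n → Y) | C.dec ω.2 ≠ some ω.1} := rfl
  unfold Code.errorProb
  rw [hset, ← PMF.toOuterMeasure_map_apply, PMF.toOuterMeasure_apply_fintype, ENNReal.toReal_sum,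
    Fintype.sum_prod_type]
  · refine Finset.sum_congr rfl fun m _ => ?_
    rw [Finset.mul_sum]
    refine Finset.sum_congr rfl fun y _ => ?_
    have := C.law_map_apply W pS Prod.fst m y
    by_cases h : C.dec y = some m
    · simp [h]
    · rw [Set.indicator_of_mem (show (m, y) ∈ _ from h), this, if_neg h, mul_one]
  · intro ω _
    refine ne_top_of_le_ne_top (PMF.apply_ne_top _ ω) (Set.indicator_le_self _ _ _)

/-- The message information is the difference of the codeword information and the information
that the codeword carries given the message. -/
theorem weightInfo_comp {ι α β : Type*} [Fintype ι] [Fintype α] [Fintype β] {w : ι → ℝ}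
    {p : ι → α → ℝ} (hp : ∀ i, ∑ a, p i a = 1) (V : α → β → ℝ) :
    weightInfo w (fun i b => ∑ a, p i a * V a b) =
      weightInfo (fun a => ∑ i, w i * p i a) V - ∑ i, w i * weightInfo (p i) V := by
  have e1 : ∀ b, ∑ i, w i * ∑ a, p i a * V a b = ∑ a, (∑ i, w i * p i a) * V a b := fun b => by
    simp only [Finset.mul_sum, Finset.sum_mul]
    rw [Finset.sum_comm]
    simp only [mul_assoc]
  have e2 : ∑ a, ∑ i, w i * p i a = ∑ i, w i := by
    rw [Finset.sum_comm]
    simp only [← Finset.mul_sum, hp, mul_one]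
  have e3 : ∀ h : α → ℝ, ∑ i, w i * ∑ a, p i a * h a = ∑ a, (∑ i, w i * p i a) * h a := by
    intro h
    simp only [Finset.mul_sum, Finset.sum_mul]
    rw [Finset.sum_comm]
    simp only [mul_assoc]
  unfold weightInfo
  simp only [e1, e2, hp, negMulLog_one, sub_zero, mul_sub, Finset.sum_sub_distrib, e3]
  ring

theorem weightInfo_eq_sum_log {α β : Type*} [Fintype α] [Fintype β] {w : α → ℝ}
    (hw : ∑ a, w a = 1) (V : α → β → ℝ) :
    weightInfo w V = ∑ a, ∑ b, w a * V a b * (log (V a b) - log (∑ a, w a * V a b)) := by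
  have e1 : ∑ b, negMulLog (∑ a, w a * V a b) =
      -∑ a, ∑ b, w a * V a b * log (∑ a, w a * V a b) := by
    rw [Finset.sum_comm, ← Finset.sum_neg_distrib]
    refine Finset.sum_congr rfl fun b _ => ?_
    rw [← Finset.sum_mul, negMulLog]
    ring
  unfold weightInfo
  rw [e1, hw, negMulLog_one]
  simp only [mul_sub, Finset.sum_sub_distrib, Finset.mul_sum, negMulLog]
  simp only [mul_assoc, neg_mul, mul_neg, Finset.sum_neg_distrib]
  ring

open Classical in
/-- Fano's inequality for a uniform message. -/
theorem fano {β : Type*} [Fintype β] [NeZero M] {V : Fin M → β → ℝ} (hV : IsKernel V)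
    (f : β → Option (Fin M)) :
    (1 - ∑ m, (M : ℝ)⁻¹ * ∑ b, V m b * if f b = some m then 0 else 1) * log M - log 2 ≤
      weightInfo (fun _ => (M : ℝ)⁻¹) V := by
  have hM : (0 : ℝ) < M := Nat.cast_pos.2 (Nat.pos_of_ne_zero (NeZero.ne M))
  have hM1 : (1 : ℝ) ≤ M := Nat.one_le_cast.2 (Nat.pos_of_ne_zero (NeZero.ne M))
  have hw : ∑ _m : Fin M, (M : ℝ)⁻¹ = 1 := by simp [hM.ne']
  set P : β → ℝ := fun b => ∑ m, (M : ℝ)⁻¹ * V m b with hP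
  have hP0 : ∀ b, 0 ≤ P b := fun b => Finset.sum_nonneg fun m _ =>
    mul_nonneg (inv_nonneg.2 hM.le) (hV.nonneg m b)
  -- A guess at the message from the output: half the mass on the decoded message, half uniform.
  -- Gibbs' inequality against it costs at most `log 2`, plus `log M` on an error, so no binary
  -- entropy appears. If the decoder outputs `none`, the guess has total mass `1/2` only, which is
  -- still admissible.
  set q : Fin M → β → ℝ := fun m b => (if f b = some m then 2⁻¹ else 0) + 2⁻¹ * (M : ℝ)⁻¹ with hq
  have hq0 : ∀ m b, 0 < q m b := fun m b => by
    have : 0 < 2⁻¹ * (M : ℝ)⁻¹ := by positivity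
    simp only [hq]; split_ifs <;> linarith
  have hPV : ∀ m b, P b = 0 → V m b = 0 := fun m b h => by
    have := (Finset.sum_eq_zero_iff_of_nonneg fun m _ =>
      mul_nonneg (inv_nonneg.2 hM.le) (hV.nonneg m b)).1 h m (Finset.mem_univ _)
    simpa [hM.ne'] using this
  have hG := sum_mul_log_sub_log_nonneg (ι := Fin M × β) (fun p => (M : ℝ)⁻¹ * V p.1 p.2)
    (fun p => q p.1 p.2 * P p.2) (fun p => mul_nonneg (inv_nonneg.2 hM.le) (hV.nonneg _ _))
    (fun p => mul_nonneg (hq0 _ _).le (hP0 _))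
    (fun p h => by rw [hPV p.1 p.2 (by simpa [(hq0 _ _).ne'] using h), mul_zero]) (by
      rw [Fintype.sum_prod_type, Finset.sum_comm' (t' := Finset.univ) (s' := fun _ => Finset.univ)
        (by simp)]
      have hqs : ∀ b, ∑ m, q m b ≤ 1 := fun b => by
        simp only [hq, Finset.sum_add_distrib, ← Finset.mul_sum, hw]
        have : ∑ m, (if f b = some m then (2 : ℝ)⁻¹ else 0) ≤ 2⁻¹ := by
          cases h : f b with
          | none => simp
          | some m => simp
        linarith
      calc ∑ b, ∑ m, q m b * P b ≤ ∑ b, P b := by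
            refine Finset.sum_le_sum fun b _ => ?_
            rw [← Finset.sum_mul]
            exact mul_le_of_le_one_left (hP0 b) (hqs b)
        _ ≤ _ := by
            rw [Fintype.sum_prod_type, Finset.sum_comm])
  rw [weightInfo_eq_sum_log hw]
  rw [Fintype.sum_prod_type] at hG
  have hpt : ∀ m b, (M : ℝ)⁻¹ * V m b * (log ((M : ℝ)⁻¹ * V m b) - log (q m b * P b)) ≤
      (M : ℝ)⁻¹ * V m b * (log (V m b) - log (P b)) +
        ((M : ℝ)⁻¹ * (V m b * if f b = some m then 0 else 1) * log M -
          (M : ℝ)⁻¹ * V m b * (log M - log 2)) := by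
    intro m b
    rcases (hV.nonneg m b).eq_or_lt with h | h
    · simp [← h]
    have hPb : P b ≠ 0 := fun h' => h.ne' (hPV m b h')
    rw [log_mul (inv_ne_zero hM.ne') h.ne', log_mul (hq0 m b).ne' hPb, log_inv]
    have hlq : -log 2 - (if f b = some m then 0 else 1) * log M ≤ log (q m b) := by
      simp only [hq]
      split_ifs with hf
      · rw [zero_mul, sub_zero, ← log_inv]
        exact log_le_log (by norm_num) (by have : 0 < 2⁻¹ * (M : ℝ)⁻¹ := by positivity
                                           linarith)
      · rw [zero_add, log_mul (by norm_num) (inv_ne_zero hM.ne'), log_inv, log_inv]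
        linarith
    have := mul_le_mul_of_nonneg_left hlq (mul_nonneg (inv_nonneg.2 hM.le) h.le)
    linarith
  have hsum := Finset.sum_le_sum fun m (_ : m ∈ Finset.univ) =>
    Finset.sum_le_sum fun b (_ : b ∈ Finset.univ) => hpt m b
  have h3 : ∑ m : Fin M, ∑ b, (M : ℝ)⁻¹ * V m b = 1 := by
    simpa only [← Finset.mul_sum, hV.sum_eq_one, mul_one] using hw
  simp only [Finset.sum_add_distrib, Finset.sum_sub_distrib] at hsum
  rw [← Finset.sum_sub_distrib] at hsum
  simp only [← Finset.sum_mul, h3, Finset.sum_sub_distrib] at hsum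
  have h4 : ∑ m : Fin M, ∑ b, (M : ℝ)⁻¹ * (V m b * if f b = some m then 0 else 1) =
    ∑ m, (M : ℝ)⁻¹ * ∑ b, V m b * if f b = some m then 0 else 1 := by
    simp only [Finset.mul_sum]
  rw [h4] at hsum
  linarith

end code

/-! ### The single-letter expression in terms of the region of pairs of informations -/

theorem exists_pmf_of_mem_stdSimplex {α : Type*} [Fintype α] {p : α → ℝ}
    (hp : p ∈ stdSimplex ℝ α) : ∃ P : PMF α, ∀ a, (P a).toReal = p a := by
  refine ⟨PMF.ofFintype (fun a => ENNReal.ofReal (p a)) ?_, fun a => ?_⟩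
  · rw [← ENNReal.ofReal_sum_of_nonneg fun a _ => hp.1 a, hp.2, ENNReal.ofReal_one]
  · rw [PMF.ofFintype_apply, ENNReal.toReal_ofReal (hp.1 a)]

theorem toReal_mem_stdSimplex {α : Type*} [Fintype α] (p : PMF α) :
    (fun a => (p a).toReal) ∈ stdSimplex ℝ α :=
  ⟨fun _ => ENNReal.toReal_nonneg, PMF_sum_toReal p⟩

section

variable {S X Y Z : Type*} [Fintype X] [Fintype Y] [Fintype Z]

/-- The convex hull of the pairs `(I(X;Y), I(X;Z))`, in nats, over all input distributions; these
are the pairs `(I(X;Y|U), I(X;Z|U))`. -/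
def wiretapRegion (W : X → PMF (Y × Z)) : Set (ℝ × ℝ) :=
  convexHull ℝ (infoRegion (out W Prod.fst) (out W Prod.snd))

theorem isCompact_wiretapRegion (W : X → PMF (Y × Z)) : IsCompact (wiretapRegion W) :=
  isCompact_convexHull_of_isCompact (isCompact_infoRegion _ _)

theorem LessCapable.snd_le_fst {W : X → PMF (Y × Z)} (hW : LessCapable W) {v : ℝ × ℝ}
    (hv : v ∈ wiretapRegion W) : v.2 ≤ v.1 := by
  rw [lessCapable_iff] at hW
  refine convexHull_min (t := {v : ℝ × ℝ | v.2 ≤ v.1}) ?_ ?_ hv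
  · rintro _ ⟨p, hp, rfl⟩
    obtain ⟨P, hP⟩ := exists_pmf_of_mem_stdSimplex hp
    have := hW P
    simp only [hP] at this
    exact this
  · intro x hx y hy a b ha hb _
    exact add_le_add (mul_le_mul_of_nonneg_left hx ha) (mul_le_mul_of_nonneg_left hy hb)

theorem snd_nonneg_of_mem_wiretapRegion {W : X → PMF (Y × Z)} {v : ℝ × ℝ}
    (hv : v ∈ wiretapRegion W) : 0 ≤ v.2 := by
  refine convexHull_min (t := {v : ℝ × ℝ | 0 ≤ v.2}) ?_ ?_ hv
  · rintro _ ⟨p, hp, rfl⟩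
    exact weightInfo_nonneg _ hp.1 (isKernel_out _ _)
  · exact convex_halfSpace_ge (LinearMap.snd ℝ ℝ ℝ).isLinear 0

theorem zero_mem_wiretapRegion [Nonempty X] (W : X → PMF (Y × Z)) :
    (0 : ℝ × ℝ) ∈ wiretapRegion W := by
  classical
  refine subset_convexHull ℝ _ ⟨_, single_mem_stdSimplex ℝ (Classical.arbitrary X), ?_⟩
  ext <;> simp [weightInfo, Pi.single_apply]

/-- A point of the hull is a mixture of information pairs, and its mixing weights are the law of
`U`. -/
theorem mem_secrecyValues_iff (W : X → PMF (Y × Z)) (pS : PMF S) (r : ℝ) :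
    r ∈ secrecyValues W pS ↔ ∃ v ∈ wiretapRegion W,
      ENNReal.ofReal (v.2 / log 2) ≤ discreteEntropy pS ∧ r = (v.1 - v.2) / log 2 := by
  constructor
  · rintro ⟨k, l, _, ⟨⟨pU, pV, pX, rfl⟩, h⟩, rfl⟩
    have hZ := condMutualInfo_auxLaw pU pV pX W Prod.snd
    have hY := condMutualInfo_auxLaw pU pV pX W Prod.fst
    rw [hZ] at h
    rw [hZ, hY]
    simp only [weightInfo_smul _ _ (isKernel_out W _)] at h ⊢
    refine ⟨∑ u, (pU u).toReal • (weightInfo (fun x => (((pV u).bind pX) x).toReal)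
      (out W Prod.fst), weightInfo (fun x => (((pV u).bind pX) x).toReal) (out W Prod.snd)),
      mem_convexHull_of_exists_fintype _ _ (fun u => ENNReal.toReal_nonneg) (PMF_sum_toReal pU)
      (fun u => ⟨_, toReal_mem_stdSimplex _, rfl⟩) rfl, ?_, ?_⟩
    · simpa [Prod.snd_sum] using h
    · simp [Prod.fst_sum, Prod.snd_sum, sub_div]
  · rintro ⟨v, hv, h, rfl⟩
    obtain ⟨ι, _, w, z, hw, hw1, hz, rfl⟩ := mem_convexHull_iff_exists_fintype.1 hv
    choose p hp hpz using hz
    obtain ⟨PU, hPU⟩ := exists_pmf_of_mem_stdSimplex (p := fun u => w ((Fintype.equivFin ι).symm u))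
      ⟨fun u => hw _, by rw [(Fintype.equivFin ι).symm.sum_comp, hw1]⟩
    choose PX hPX using fun i => exists_pmf_of_mem_stdSimplex (hp i)
    -- Conversely `V` is taken to be a copy of `X`, relabelled to live on some `Fin l`.
    let e := Fintype.equivFin X
    have hbind : ∀ u, (((PX ((Fintype.equivFin ι).symm u)).map e).bind fun v => PMF.pure (e.symm v)) =
        PX ((Fintype.equivFin ι).symm u) := fun u => by
      rw [PMF.bind_map]
      simp [Function.comp_def, PMF.bind_pure]
    have hZ := condMutualInfo_auxLaw PU (fun u => (PX ((Fintype.equivFin ι).symm u)).map e)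
      (fun v => PMF.pure (e.symm v)) W Prod.snd
    have hY := condMutualInfo_auxLaw PU (fun u => (PX ((Fintype.equivFin ι).symm u)).map e)
      (fun v => PMF.pure (e.symm v)) W Prod.fst
    simp only [hbind, weightInfo_smul _ _ (isKernel_out W _), hPU, hPX] at hZ hY
    rw [(Fintype.equivFin ι).symm.sum_comp fun i => w i * weightInfo (p i) _] at hZ hY
    have hsum : ∑ i, w i • z i = (∑ i, w i * weightInfo (p i) (out W Prod.fst),
        ∑ i, w i * weightInfo (p i) (out W Prod.snd)) := by
      ext <;> simp [Prod.fst_sum, Prod.snd_sum, ← hpz]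
    rw [hsum] at h ⊢
    refine ⟨_, _, _, ⟨⟨PU, _, _, rfl⟩, (congrArg ENNReal.ofReal hZ).trans_le h⟩, ?_⟩
    rw [sub_div]
    exact (congrArg₂ (· - ·) hY hZ).symm

theorem exists_isGreatest_secrecyValues [Nonempty X] (W : X → PMF (Y × Z)) (pS : PMF S) :
    ∃ r, IsGreatest (secrecyValues W pS) r := by
  have hcl : IsClosed {v : ℝ × ℝ | ENNReal.ofReal (v.2 / log 2) ≤ discreteEntropy pS} :=
    isClosed_le (ENNReal.continuous_ofReal.comp (by fun_prop)) continuous_const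
  obtain ⟨v, ⟨hv, hv'⟩, hmax⟩ := ((isCompact_wiretapRegion W).inter_right hcl).exists_isMaxOn
    (f := fun v : ℝ × ℝ => (v.1 - v.2) / log 2) ⟨0, zero_mem_wiretapRegion W, by simp⟩
    (by fun_prop)
  refine ⟨(v.1 - v.2) / log 2, (mem_secrecyValues_iff W pS _).2 ⟨v, hv, hv', rfl⟩, ?_⟩
  intro r hr
  obtain ⟨u, hu, hu', rfl⟩ := (mem_secrecyValues_iff W pS _).1 hr
  exact hmax ⟨hu, hu'⟩

/-! ### The converse -/

/-- One point `v` must serve both bounds, the rate and the randomness constraint. The quantifier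
over real `h` makes the second bound vacuous when the source entropy is infinite. -/
theorem Code.exists_mem_wiretapRegion [Nonempty X] {M n : ℕ} [NeZero M] (hn : n ≠ 0)
    {W : X → PMF (Y × Z)} (hW : LessCapable W) (pS : PMF S) (C : Code S X Y M n) :
    ∃ v ∈ wiretapRegion W,
      (1 - C.errorProb W pS) * log M - log 2 - C.leakage W pS * log 2 ≤ n * (v.1 - v.2) ∧
      ∀ h : ℝ, 0 ≤ h → discreteEntropy pS ≤ ENNReal.ofReal h →
        n * v.2 ≤ C.leakage W pS * log 2 + n * h * log 2 := by
  have hl2 : 0 < log 2 := log_pos one_lt_two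
  have hM : (0 : ℝ) < M := Nat.cast_pos.2 (Nat.pos_of_ne_zero (NeZero.ne M))
  have hMi : (0 : ℝ) ≤ (M : ℝ)⁻¹ := inv_nonneg.2 hM.le
  have hw : ∑ _m : Fin M, (M : ℝ)⁻¹ = 1 := by simp [hM.ne']
  have hn0 : (0 : ℝ) < n := Nat.cast_pos.2 (Nat.pos_of_ne_zero hn)
  have kY := isKernel_out W Prod.fst
  have kZ := isKernel_out W Prod.snd
  have hSL := singleLetter_powKernel kY kZ n
  have hconv : Convex ℝ (wiretapRegion W) := convex_convexHull ℝ _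
  set VY := out W Prod.fst
  set VZ := out W Prod.snd
  set p : Fin M → (Fin n → X) → ℝ := fun m x => (C.inputLaw pS m x).toReal with hpdef
  have hp : ∀ m, ∑ x, p m x = 1 := fun m => PMF_sum_toReal _
  have hp0 : ∀ m x, 0 ≤ p m x := fun m x => ENNReal.toReal_nonneg
  set q : (Fin n → X) → ℝ := fun x => ∑ m, (M : ℝ)⁻¹ * p m x with hq
  have hq1 : ∑ x, q x = 1 := by
    rw [hq, Finset.sum_comm]
    simp only [← Finset.mul_sum, hp, mul_one]
    exact hw
  have cY : weightInfo (fun _ => (M : ℝ)⁻¹) (C.kernel pS VY) =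
    weightInfo q (powKernel n VY) - ∑ m, (M : ℝ)⁻¹ * weightInfo (p m) (powKernel n VY) :=
    weightInfo_comp hp _
  have cZ : weightInfo (fun _ => (M : ℝ)⁻¹) (C.kernel pS VZ) =
    weightInfo q (powKernel n VZ) - ∑ m, (M : ℝ)⁻¹ * weightInfo (p m) (powKernel n VZ) :=
    weightInfo_comp hp _
  have hleak : weightInfo (fun _ => (M : ℝ)⁻¹) (C.kernel pS VZ) = C.leakage W pS * log 2 := by
    rw [C.leakage_eq, div_mul_cancel₀ _ hl2.ne']
  have hfano := fano (C.isKernel_kernel pS kY) C.dec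
  rw [← C.errorProb_eq] at hfano
  -- Less capable passes to `n` uses: the difference of informations is `n (v.1 - v.2)` for some `v`
  -- in the hull.
  have hlc : ∀ m, weightInfo (p m) (powKernel n VZ) ≤ weightInfo (p m) (powKernel n VY) := by
    intro m
    obtain ⟨v, hv, h1, -⟩ := hSL (p m) (hp0 m)
    obtain ⟨v, hv, rfl⟩ := hv
    have := hW.snd_le_fst hv
    rw [hp m, mul_one] at h1
    have h2 : (n : ℝ) * v.2 ≤ n * v.1 := mul_le_mul_of_nonneg_left this hn0.le
    simp only [Prod.smul_fst, Prod.smul_snd, smul_eq_mul] at h1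
    linarith
  have havg : ∑ m, (M : ℝ)⁻¹ * weightInfo (p m) (powKernel n VZ) ≤
      ∑ m, (M : ℝ)⁻¹ * weightInfo (p m) (powKernel n VY) :=
    Finset.sum_le_sum fun m _ => mul_le_mul_of_nonneg_left (hlc m) hMi
  obtain ⟨_, ⟨v, hv, rfl⟩, h1, h2⟩ := hSL q fun x =>
    Finset.sum_nonneg fun m _ => mul_nonneg hMi (hp0 m x)
  rw [hq1, mul_one] at h1 h2
  simp only [Prod.smul_fst, Prod.smul_snd, smul_eq_mul] at h1 h2
  refine ⟨v, hv, by linarith, fun h hh hS => ?_⟩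
  -- Given the message, the codeword is a function of `n` source symbols, so its entropy is at most
  -- `n h` bits.
  have hent : ∀ m, weightInfo (p m) (powKernel n VZ) ≤ n * h * log 2 := by
    intro m
    have h3 := weightInfo_le_sum_negMulLog (p m) (hp0 m) (kZ.pow n)
    rw [hp m, negMulLog_one, sub_zero] at h3
    have h4 : discreteEntropy (C.inputLaw pS m) ≤ ENNReal.ofReal (n * h) :=
      (discreteEntropy_map_le _ _).trans <| (discreteEntropy_productPMF_le pS n).trans <| by
        rw [ENNReal.ofReal_mul hn0.le, ENNReal.ofReal_natCast]
        exact mul_le_mul_right hS _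
    rw [discreteEntropy_eq_ofReal_entropy, ENNReal.ofReal_le_ofReal_iff (by positivity),
      entropy_eq, div_le_iff₀ hl2] at h4
    exact h3.trans h4
  have hsum : ∑ m, (M : ℝ)⁻¹ * weightInfo (p m) (powKernel n VZ) ≤ n * h * log 2 :=
    calc _ ≤ ∑ _m : Fin M, (M : ℝ)⁻¹ * (n * h * log 2) :=
          Finset.sum_le_sum fun m _ => mul_le_mul_of_nonneg_left (hent m) hMi
      _ = _ := by rw [← Finset.sum_mul, hw, one_mul]
  linarith

theorem Achievable.exists_mem_wiretapRegion [Nonempty X] {W : X → PMF (Y × Z)}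
    (hW : LessCapable W) {pS : PMF S} {R : ℝ} (hR : Achievable W pS R) :
    ∃ v ∈ wiretapRegion W, ENNReal.ofReal (v.2 / log 2) ≤ discreteEntropy pS ∧
      R * log 2 ≤ v.1 - v.2 := by
  have hl2 : 0 < log 2 := log_pos one_lt_two
  obtain ⟨hR0, C, he, hl⟩ := hR
  -- Blocklengths start at `1`, since the bounds are to be divided by the blocklength.
  have h := fun n : ℕ => (C (n + 1)).exists_mem_wiretapRegion n.succ_ne_zero hW pS
  choose v hv h1 h2 using h
  obtain ⟨u, hu, φ, hφ, hlim⟩ := (isCompact_wiretapRegion W).tendsto_subseq hv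
  have he' := (he.comp (tendsto_add_atTop_nat 1)).comp hφ.tendsto_atTop
  have hl' := (hl.comp (tendsto_add_atTop_nat 1)).comp hφ.tendsto_atTop
  have hinv : Tendsto (fun k => ((φ k + 1 : ℕ) : ℝ)⁻¹) atTop (𝓝 0) :=
    tendsto_inv_atTop_nhds_zero_nat.comp ((tendsto_add_atTop_nat 1).comp hφ.tendsto_atTop)
  have hu1 : Tendsto (fun k => (v (φ k)).1) atTop (𝓝 u.1) := (continuous_fst.tendsto u).comp hlim
  have hu2 : Tendsto (fun k => (v (φ k)).2) atTop (𝓝 u.2) := (continuous_snd.tendsto u).comp hlim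
  refine ⟨u, hu, ?_, ?_⟩
  · rcases eq_or_ne (discreteEntropy pS) ∞ with htop | htop
    · rw [htop]; exact le_top
    set h := (discreteEntropy pS).toReal
    have hh : discreteEntropy pS = ENNReal.ofReal h := (ENNReal.ofReal_toReal htop).symm
    rw [hh]
    refine ENNReal.ofReal_le_ofReal ?_
    rw [div_le_iff₀ hl2]
    have lim : Tendsto (fun k => (C (φ k + 1)).leakage W pS * log 2 * ((φ k + 1 : ℕ) : ℝ)⁻¹ +
        h * log 2) atTop (𝓝 (0 * log 2 * 0 + h * log 2)) :=
      ((hl'.mul_const _).mul hinv).add_const _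
    simp only [mul_zero, zero_add] at lim
    refine le_of_tendsto_of_tendsto' hu2 lim fun k => ?_
    have := h2 (φ k) h ENNReal.toReal_nonneg hh.le
    have hpos : (0 : ℝ) < ((φ k + 1 : ℕ) : ℝ) := Nat.cast_pos.2 (Nat.succ_pos _)
    rw [← mul_le_mul_iff_right₀ hpos]
    refine this.trans_eq ?_
    field_simp
  · have lim : Tendsto (fun k => (1 - (C (φ k + 1)).errorProb W pS) * (R * log 2) -
        log 2 * ((φ k + 1 : ℕ) : ℝ)⁻¹ - (C (φ k + 1)).leakage W pS * log 2 *
          ((φ k + 1 : ℕ) : ℝ)⁻¹) atTop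
        (𝓝 ((1 - 0) * (R * log 2) - log 2 * 0 - 0 * log 2 * 0)) :=
      (((tendsto_const_nhds.sub he').mul_const _).sub (hinv.const_mul _)).sub
        ((hl'.mul_const _).mul hinv)
    simp only [sub_zero, one_mul, mul_zero] at lim
    refine le_of_tendsto_of_tendsto lim (hu1.sub hu2) ?_
    -- Once the error probability is below `1`, the factor `1 - Pₑ` is positive and `log M` may be
    -- replaced by its lower bound `n R log 2`.
    filter_upwards [he'.eventually (gt_mem_nhds one_pos)] with k hk
    have := h1 (φ k)
    have hpos : (0 : ℝ) < ((φ k + 1 : ℕ) : ℝ) := Nat.cast_pos.2 (Nat.succ_pos _)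
    have hlog : ((φ k + 1 : ℕ) : ℝ) * R * log 2 ≤ log (numMessages R (φ k + 1)) := by
      rw [← log_rpow two_pos]
      exact log_le_log (by positivity) (Nat.le_ceil _)
    have h3 : (1 - (C (φ k + 1)).errorProb W pS) * (((φ k + 1 : ℕ) : ℝ) * R * log 2) ≤
        (1 - (C (φ k + 1)).errorProb W pS) * log (numMessages R (φ k + 1)) :=
      mul_le_mul_of_nonneg_left hlog (sub_nonneg.2 (le_of_lt hk))
    rw [← mul_le_mul_iff_right₀ hpos]
    refine le_trans (le_of_eq ?_) (le_trans (sub_le_sub_right (sub_le_sub_right h3 (log 2)) _) this)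
    field_simp

end

/-! ### Random codebooks -/

section marginals

variable {J α : Type*} [Fintype J] [DecidableEq J] [Fintype α] {p : α → ℝ}

theorem sum_prod_weight (hp : ∑ x, p x = 1) : ∑ c : J → α, ∏ j, p (c j) = 1 := by
  rw [← Fintype.prod_sum fun _ : J => p]
  simp [hp]

theorem sum_prod_weight_mul (hp : ∑ x, p x = 1) (j₀ : J) (g : α → ℝ) :
    ∑ c : J → α, (∏ j, p (c j)) * g (c j₀) = ∑ x, p x * g x := by
  have h : ∀ c : J → α, (∏ j, p (c j)) * g (c j₀) =
      ∏ j, p (c j) * if j = j₀ then g (c j) else 1 := fun c => by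
    rw [Finset.prod_mul_distrib, Finset.prod_ite_eq' Finset.univ j₀, if_pos (Finset.mem_univ _)]
  simp only [h]
  rw [← Fintype.prod_sum fun (j : J) x => p x * if j = j₀ then g x else 1,
    Finset.prod_eq_single j₀]
  · simp
  · intro j _ hj
    simp [hj, hp]
  · simp

/-- Pairwise independence of codewords; both random coding bounds rest on it. -/
theorem sum_prod_weight_mul_mul (hp : ∑ x, p x = 1) {j₀ j₁ : J} (hj : j₀ ≠ j₁) (g h : α → ℝ) :
    ∑ c : J → α, (∏ j, p (c j)) * (g (c j₀) * h (c j₁)) =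
      (∑ x, p x * g x) * ∑ x, p x * h x := by
  have e : ∀ c : J → α, (∏ j, p (c j)) * (g (c j₀) * h (c j₁)) =
      ∏ j, p (c j) * ((if j = j₀ then g (c j) else 1) * if j = j₁ then h (c j) else 1) :=
    fun c => by
      rw [Finset.prod_mul_distrib, Finset.prod_mul_distrib, Finset.prod_ite_eq' Finset.univ j₀,
        Finset.prod_ite_eq' Finset.univ j₁, if_pos (Finset.mem_univ _), if_pos (Finset.mem_univ _)]
  simp only [e]
  rw [← Fintype.prod_sum fun (j : J) x =>
    p x * ((if j = j₀ then g x else 1) * if j = j₁ then h x else 1),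
    ← Finset.prod_erase_mul _ _ (Finset.mem_univ j₀),
    ← Finset.prod_erase_mul _ _ (Finset.mem_erase.2 ⟨hj.symm, Finset.mem_univ j₁⟩),
    Finset.prod_eq_one]
  · simp [hj, hj.symm, mul_comm]
  · intro j hj'
    simp only [Finset.mem_erase] at hj'
    simp [hj'.1, hj'.2.1, hp]

end marginals

section coding

variable {R A B : Type*} [Fintype R] [Fintype A] [Fintype B] {M : ℕ}

/-- The maximum a posteriori decoder of the message, for the codebook `c` and the law `q` of the
local randomness. -/
noncomputable def mapDecoder [NeZero M] [Nonempty R] (q : R → ℝ) (V : A → B → ℝ)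
    (c : Fin M × R → A) (b : B) : Fin M :=
  (Finite.exists_max fun j : Fin M × R => q j.2 * V (c j) b).choose.1

omit [Fintype A] [Fintype B] in
theorem exists_of_mapDecoder_ne [NeZero M] [Nonempty R] (q : R → ℝ) (V : A → B → ℝ)
    (c : Fin M × R → A) (b : B) (j : Fin M × R) (h : mapDecoder q V c b ≠ j.1) :
    ∃ j', j' ≠ j ∧ q j.2 * V (c j) b ≤ q j'.2 * V (c j') b := by
  have hs := (Finite.exists_max fun j : Fin M × R => q j.2 * V (c j) b).choose_spec
  exact ⟨_, fun h' => h (congrArg Prod.fst h'), hs j⟩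

variable {p : A → ℝ} (hp0 : ∀ a, 0 ≤ p a) (hp : ∑ a, p a = 1)
  {q : R → ℝ} (hq0 : ∀ r, 0 ≤ q r) (hq : ∑ r, q r = 1) {V : A → B → ℝ} (hV : IsKernel V)

include hp0 hp hq0 hq hV

open Classical in
-- Let `x = q j.2 * V (c j) b` be the score of the true pair. An error requires a rival scoring at
-- least `x`, so the loss is at most `x` and at most the sum of the rival scores. The rival
-- codewords are independent of `c j`, so that sum has mean at most `M Q`. Finally `min x (M Q) ≤ x
-- ^ (1 - s) * (M Q) ^ s`.
theorem sum_codebook_error_le_aux [NeZero M] [Nonempty R] {s : ℝ} (hs : 0 ≤ s) (hs1 : s ≤ 1)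
    (j : Fin M × R) (b : B) :
    ∑ c : Fin M × R → A, (∏ j, p (c j)) *
        (q j.2 * V (c j) b * if mapDecoder q V c b = j.1 then 0 else 1) ≤
      ∑ a, p a * ((q j.2 * V a b) ^ (1 - s) * (M * ∑ a, p a * V a b) ^ s) := by
  set Q := ∑ a, p a * V a b with hQ
  have hQ0 : 0 ≤ Q := Finset.sum_nonneg fun a _ => mul_nonneg (hp0 a) (hV.nonneg a b)
  have hb0 : (0 : ℝ) ≤ M * Q := by positivity
  have ha0 : ∀ (j : Fin M × R) a, 0 ≤ q j.2 * V a b := fun j a =>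
    mul_nonneg (hq0 _) (hV.nonneg a b)
  have hmul : ∀ x : ℝ, 0 ≤ x → x = x ^ (1 - s) * x ^ s := by
    intro x hx
    rw [← rpow_add_of_nonneg hx (by linarith) hs]
    simp
  set T : A → ℝ := fun a => (q j.2 * V a b) ^ (1 - s) * (M * Q) ^ s with hT
  -- `F` handles a true score of at most `M Q`; `G` indicates the other case, where the union bound
  -- over rivals is used.
  set F : A → ℝ := fun a => if q j.2 * V a b ≤ M * Q then T a else 0 with hF
  set G : A → ℝ := fun a => if q j.2 * V a b ≤ M * Q then 0 else 1 with hG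
  have hG0 : ∀ a, 0 ≤ G a := fun a => by simp only [hG]; split_ifs <;> norm_num
  have hpt : ∀ c : Fin M × R → A,
      (q j.2 * V (c j) b * if mapDecoder q V c b = j.1 then 0 else 1) ≤
        F (c j) + ∑ j' ∈ Finset.univ.erase j, G (c j) * (q j'.2 * V (c j') b) := by
    intro c
    have hsum : ∀ j' ∈ Finset.univ.erase j, 0 ≤ G (c j) * (q j'.2 * V (c j') b) :=
      fun j' _ => mul_nonneg (hG0 _) (ha0 _ _)
    have hT0 : 0 ≤ T (c j) := mul_nonneg (rpow_nonneg (ha0 _ _) _) (rpow_nonneg hb0 _)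
    have hF0 : 0 ≤ F (c j) := by simp only [hF]; split_ifs <;> simp [hT0]
    split_ifs with h
    · rw [mul_zero]
      exact add_nonneg hF0 (Finset.sum_nonneg hsum)
    · rw [mul_one]
      by_cases hle : q j.2 * V (c j) b ≤ M * Q
      · have h1 : q j.2 * V (c j) b ≤ F (c j) := by
          simp only [hF, if_pos hle]
          exact (hmul _ (ha0 _ _)).le.trans
            (mul_le_mul_of_nonneg_left (rpow_le_rpow (ha0 _ _) hle hs) (rpow_nonneg (ha0 _ _) _))
        exact h1.trans (le_add_of_nonneg_right (Finset.sum_nonneg hsum))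
      · obtain ⟨j', hj', hle'⟩ := exists_of_mapDecoder_ne q V c b j h
        have h1 := Finset.single_le_sum hsum (Finset.mem_erase.2 ⟨hj', Finset.mem_univ _⟩)
        have h2 : G (c j) = 1 := by simp only [hG, if_neg hle]
        simp only [h2, one_mul] at h1 ⊢
        linarith
  calc _ ≤ ∑ c : Fin M × R → A, (∏ j, p (c j)) *
        (F (c j) + ∑ j' ∈ Finset.univ.erase j, G (c j) * (q j'.2 * V (c j') b)) :=
        Finset.sum_le_sum fun c _ => mul_le_mul_of_nonneg_left (hpt c)
          (Finset.prod_nonneg fun j _ => hp0 _)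
    _ = ∑ a, p a * F a + ∑ j' ∈ Finset.univ.erase j,
        (∑ a, p a * G a) * ∑ a, p a * (q j'.2 * V a b) := by
        simp only [mul_add, Finset.sum_add_distrib, sum_prod_weight_mul hp j, Finset.mul_sum]
        congr 1
        rw [Finset.sum_comm]
        refine Finset.sum_congr rfl fun j' hj' => ?_
        rw [sum_prod_weight_mul_mul hp (Finset.mem_erase.1 hj').1.symm G fun a => q j'.2 * V a b]
        simp only [Finset.mul_sum]
    _ = ∑ a, p a * F a + (∑ a, p a * G a) * ((∑ j' ∈ Finset.univ.erase j, q j'.2) * Q) := by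
        simp only [mul_left_comm (p _), ← Finset.mul_sum, ← Finset.sum_mul]
        rfl
    _ ≤ ∑ a, p a * F a + (∑ a, p a * G a) * (M * Q) := by
        have h1 : ∑ j' ∈ Finset.univ.erase j, q j'.2 ≤ M := by
          calc _ ≤ ∑ j' : Fin M × R, q j'.2 := Finset.sum_le_sum_of_subset_of_nonneg
                (Finset.erase_subset _ _) fun _ _ _ => hq0 _
            _ = M := by rw [Fintype.sum_prod_type]; simp [hq]
        gcongr
        exact Finset.sum_nonneg fun a _ => mul_nonneg (hp0 a) (hG0 a)
    _ = ∑ a, p a * (F a + G a * (M * Q)) := by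
        simp only [mul_add, Finset.sum_add_distrib, Finset.sum_mul, mul_assoc]
    _ ≤ _ := by
        refine Finset.sum_le_sum fun a _ => mul_le_mul_of_nonneg_left ?_ (hp0 a)
        simp only [hF, hG]
        split_ifs with h
        · simp [hT]
        · rw [zero_add, one_mul]
          exact (hmul _ hb0).le.trans (mul_le_mul_of_nonneg_right
            (rpow_le_rpow hb0 (le_of_not_ge h) (by linarith)) (rpow_nonneg hb0 _))

open Classical in
/-- The expected probability of error of the random codebook. -/
theorem sum_codebook_error_le [NeZero M] [Nonempty R] {s : ℝ} (hs : 0 ≤ s) (hs1 : s ≤ 1) :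
    ∑ c : Fin M × R → A, (∏ j, p (c j)) * ∑ m, (M : ℝ)⁻¹ * ∑ b, (∑ r, q r * V (c (m, r)) b) *
        (if mapDecoder q V c b = m then 0 else 1) ≤
      (M : ℝ) ^ s * (∑ r, q r ^ (1 - s)) *
        ∑ a, ∑ b, p a * (V a b ^ (1 - s) * (∑ a, p a * V a b) ^ s) := by
  have hM : (0 : ℝ) < M := Nat.cast_pos.2 (Nat.pos_of_ne_zero (NeZero.ne M))
  have hMi : (0 : ℝ) ≤ (M : ℝ)⁻¹ := inv_nonneg.2 hM.le
  have hQ0 : ∀ b, 0 ≤ ∑ a, p a * V a b := fun b =>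
    Finset.sum_nonneg fun a _ => mul_nonneg (hp0 a) (hV.nonneg a b)
  have e : ∑ c : Fin M × R → A, (∏ j, p (c j)) * ∑ m, (M : ℝ)⁻¹ *
      ∑ b, (∑ r, q r * V (c (m, r)) b) * (if mapDecoder q V c b = m then 0 else 1) =
      ∑ m, (M : ℝ)⁻¹ * ∑ b, ∑ r, ∑ c : Fin M × R → A, (∏ j, p (c j)) *
        (q r * V (c (m, r)) b * if mapDecoder q V c b = m then 0 else 1) := by
    simp only [Finset.mul_sum, Finset.sum_mul]
    rw [Finset.sum_comm]
    refine Finset.sum_congr rfl fun m _ => ?_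
    rw [Finset.sum_comm]
    refine Finset.sum_congr rfl fun b _ => ?_
    rw [Finset.sum_comm]
    refine Finset.sum_congr rfl fun r _ => Finset.sum_congr rfl fun c _ => by ring
  rw [e]
  calc _ ≤ ∑ m : Fin M, (M : ℝ)⁻¹ * ∑ b, ∑ r,
        ∑ a, p a * ((q r * V a b) ^ (1 - s) * (M * ∑ a, p a * V a b) ^ s) := by
        refine Finset.sum_le_sum fun m _ => mul_le_mul_of_nonneg_left ?_ hMi
        exact Finset.sum_le_sum fun b _ => Finset.sum_le_sum fun r _ =>
          sum_codebook_error_le_aux hp0 hp hq0 hq hV hs hs1 (m, r) b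
    _ = ∑ b, ∑ r, ∑ a, p a * ((q r * V a b) ^ (1 - s) * (M * ∑ a, p a * V a b) ^ s) := by
        rw [← Finset.sum_mul]
        simp [hM.ne']
    _ = _ := by
        have h1 : ∀ b r a, p a * ((q r * V a b) ^ (1 - s) * (M * ∑ a, p a * V a b) ^ s) =
            q r ^ (1 - s) * ((M : ℝ) ^ s *
              (p a * (V a b ^ (1 - s) * (∑ a, p a * V a b) ^ s))) := fun b r a => by
          rw [mul_rpow (hq0 r) (hV.nonneg a b), mul_rpow hM.le (hQ0 b)]
          ring
        have h2 : ∑ a, ∑ b, p a * (V a b ^ (1 - s) * (∑ a, p a * V a b) ^ s) =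
            ∑ b, ∑ a, p a * (V a b ^ (1 - s) * (∑ a, p a * V a b) ^ s) := Finset.sum_comm
        rw [h2]
        simp only [h1, ← Finset.mul_sum, ← Finset.sum_mul]
        ring

/-- The expected divergence, averaged over the random codebook, between the channel output and
the output induced by the input distribution. -/
theorem sum_codebook_divergence_le [NeZero M] [DecidableEq R] (m : Fin M) :
    ∑ c : Fin M × R → A, (∏ j, p (c j)) * ∑ b, (∑ r, q r * V (c (m, r)) b) *
        (log (∑ r, q r * V (c (m, r)) b) - log (∑ a, p a * V a b)) ≤
      ∑ r, q r * ∑ a, ∑ b,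
        p a * V a b * log (q r * (V a b / ∑ a, p a * V a b) + (1 - q r)) := by
  have hq1 : ∀ r, q r ≤ 1 := fun r => hq ▸ Finset.single_le_sum (fun r _ => hq0 r)
    (Finset.mem_univ r)
  set Q : B → ℝ := fun b => ∑ a, p a * V a b with hQ
  have hQ0 : ∀ b, 0 ≤ Q b := fun b =>
    Finset.sum_nonneg fun a _ => mul_nonneg (hp0 a) (hV.nonneg a b)
  -- Where `Q b > 0`, this is the conditional mean, given the codeword of index `r`, of the ratio of
  -- the induced output to `Q`: the other codewords contribute `1 - q r` on average.
  set D : R → B → A → ℝ := fun r b a => q r * (V a b / Q b) + (1 - q r) with hD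
  have hD0 : ∀ r b a, 0 ≤ D r b a := fun r b a =>
    add_nonneg (mul_nonneg (hq0 r) (div_nonneg (hV.nonneg _ _) (hQ0 b))) (sub_nonneg.2 (hq1 r))
  have e : ∑ c : Fin M × R → A, (∏ j, p (c j)) * ∑ b, (∑ r, q r * V (c (m, r)) b) *
        (log (∑ r, q r * V (c (m, r)) b) - log (Q b)) =
      ∑ r, ∑ b, ∑ c : Fin M × R → A, (∏ j, p (c j)) * (q r * V (c (m, r)) b *
        (log (∑ r, q r * V (c (m, r)) b) - log (Q b))) := by
    simp only [Finset.mul_sum, Finset.sum_mul]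
    rw [Finset.sum_comm, Finset.sum_comm (γ := R)]
    refine Finset.sum_congr rfl fun b _ => ?_
    rw [Finset.sum_comm]
  have e' : ∀ r, q r * ∑ a, ∑ b, p a * V a b * log (D r b a) =
      ∑ b, ∑ a, p a * (q r * V a b * log (D r b a)) := fun r => by
    rw [Finset.mul_sum, Finset.sum_comm]
    refine Finset.sum_congr rfl fun b _ => ?_
    rw [Finset.mul_sum]
    exact Finset.sum_congr rfl fun a _ => by ring
  rw [e]
  refine le_of_le_of_eq ?_ (Finset.sum_congr rfl fun r _ => (e' r).symm)
  refine Finset.sum_le_sum fun r _ => Finset.sum_le_sum fun b _ => ?_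
  set N : A → ℝ := fun a => q r * V a b * (q r * V a b / Q b / D r b a - 1) with hN
  set L : A → ℝ := fun a => q r * V a b / D r b a / Q b with hL
  have hpt : ∀ c : Fin M × R → A, (∏ j, p (c j)) * (q r * V (c (m, r)) b *
      (log (∑ r, q r * V (c (m, r)) b) - log (Q b))) ≤
      (∏ j, p (c j)) * (q r * V (c (m, r)) b * log (D r b (c (m, r)))) +
      ((∏ j, p (c j)) * N (c (m, r)) + ∑ r' ∈ Finset.univ.erase r,
        (∏ j, p (c j)) * (L (c (m, r)) * (q r' * V (c (m, r')) b))) := by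
    intro c
    rw [← Finset.mul_sum, ← mul_add, ← mul_add]
    have hP0 : 0 ≤ ∏ j, p (c j) := Finset.prod_nonneg fun j _ => hp0 _
    rcases hP0.eq_or_lt with h | hP
    · simp [← h]
    refine mul_le_mul_of_nonneg_left ?_ hP0
    rw [← Finset.mul_sum]
    rcases (mul_nonneg (hq0 r) (hV.nonneg (c (m, r)) b)).eq_or_lt with h | h
    · simp [hN, hL, ← h]
    have hpj : 0 < p (c (m, r)) := (hp0 _).lt_of_ne fun h' =>
      hP.ne' (Finset.prod_eq_zero (Finset.mem_univ (m, r)) h'.symm)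
    have hqr : 0 < q r := (hq0 r).lt_of_ne fun h' => h.ne' (by rw [← h', zero_mul])
    have hVc : 0 < V (c (m, r)) b := (hV.nonneg _ b).lt_of_ne fun h' => h.ne' (by
      rw [← h', mul_zero])
    have hQb : 0 < Q b := (mul_pos hpj hVc).trans_le
      (Finset.single_le_sum (f := fun a => p a * V a b)
        (fun a _ => mul_nonneg (hp0 a) (hV.nonneg a b)) (Finset.mem_univ _))
    have hDp : 0 < D r b (c (m, r)) := by
      have : 0 < q r * (V (c (m, r)) b / Q b) := by positivity
      have := hq1 r
      simp only [hD]; linarith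
    set O := ∑ r' ∈ Finset.univ.erase r, q r' * V (c (m, r')) b with hO
    have hPm : ∑ r, q r * V (c (m, r)) b = q r * V (c (m, r)) b + O :=
      (Finset.add_sum_erase _ _ (Finset.mem_univ r)).symm
    have hO0 : 0 ≤ O := Finset.sum_nonneg fun r' _ => mul_nonneg (hq0 _) (hV.nonneg _ _)
    rw [hPm]
    -- Jensen's inequality through the tangent of `log` at the conditional mean `D`; the linear
    -- remainder averages to at most zero.
    have hlog := log_le_sub_one_of_pos (x := (q r * V (c (m, r)) b + O) / Q b / D r b (c (m, r)))
      (by positivity)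
    rw [log_div (by positivity) hDp.ne', log_div (by positivity) hQb.ne'] at hlog
    have h2 := mul_le_mul_of_nonneg_left hlog h.le
    have h3 : q r * V (c (m, r)) b *
        ((q r * V (c (m, r)) b + O) / Q b / D r b (c (m, r)) - 1) =
        N (c (m, r)) + L (c (m, r)) * O := by
      simp only [hN, hL]
      ring
    linarith
  refine (Finset.sum_le_sum fun c _ => hpt c).trans ?_
  simp only [Finset.sum_add_distrib]
  rw [Finset.sum_comm (t := Finset.univ.erase r)]
  have e3 : ∀ r' ∈ Finset.univ.erase r, ∑ c : Fin M × R → A, (∏ j, p (c j)) *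
      (L (c (m, r)) * (q r' * V (c (m, r')) b)) = (∑ a, p a * L a) * (q r' * Q b) := by
    intro r' hr'
    have hne : (m, r) ≠ (m, r') := fun h => (Finset.mem_erase.1 hr').1 (congrArg Prod.snd h).symm
    rw [sum_prod_weight_mul_mul hp hne L fun a => q r' * V a b]
    simp only [mul_left_comm (p _), ← Finset.mul_sum]
    rfl
  rw [Finset.sum_congr rfl e3, ← Finset.mul_sum, ← Finset.sum_mul,
    sum_prod_weight_mul hp (m, r) N,
    sum_prod_weight_mul hp (m, r) fun a => q r * V a b * log (D r b a)]
  have hqe : ∑ r' ∈ Finset.univ.erase r, q r' = 1 - q r := by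
    rw [Finset.sum_erase_eq_sub (Finset.mem_univ r), hq]
  rw [hqe, Finset.sum_mul, ← Finset.sum_add_distrib]
  refine add_le_of_nonpos_right (Finset.sum_nonpos fun a _ => ?_)
  -- The quotient `Q b / Q b` is `1`, or `0` where `Q b = 0`; either way it is at most `1`.
  have h4 : p a * N a + p a * L a * ((1 - q r) * Q b) =
      p a * (q r * V a b * ((q r * (V a b / Q b) + (1 - q r) * (Q b / Q b)) / D r b a - 1)) := by
    simp only [hN, hL]
    ring
  rw [h4]
  refine mul_nonpos_of_nonneg_of_nonpos (hp0 a)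
    (mul_nonpos_of_nonneg_of_nonpos (mul_nonneg (hq0 r) (hV.nonneg a b)) ?_)
  rw [sub_nonpos]
  refine div_le_one_of_le₀ ?_ (hD0 r b a)
  simp only [hD]
  have := mul_le_of_le_one_right (sub_nonneg.2 (hq1 r)) (div_self_le_one (Q b))
  linarith

end coding

/-! ### Selection of a codebook -/

/-- The chosen outcome must have positive weight: its codewords then lie in the support of the input
law, which `weightInfo_le_avg_divergence` requires. -/
theorem exists_le_of_sum_mul_le {Ω : Type*} [Fintype Ω] {w : Ω → ℝ} (hw : ∀ ω, 0 ≤ w ω)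
    (hw1 : ∑ ω, w ω = 1) {f : Ω → ℝ} {ε : ℝ} (h : ∑ ω, w ω * f ω ≤ ε) :
    ∃ ω, 0 < w ω ∧ f ω ≤ ε := by
  by_contra! hc
  obtain ⟨ω₀, -, h₀⟩ := Finset.exists_lt_of_sum_lt (s := Finset.univ) (f := fun _ : Ω => (0 : ℝ))
    (g := w) (by simp [hw1])
  have : ∑ ω, w ω * ε < ∑ ω, w ω * f ω := by
    refine Finset.sum_lt_sum (fun ω _ => ?_) ⟨ω₀, Finset.mem_univ _,
      mul_lt_mul_of_pos_left (hc ω₀ h₀) h₀⟩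
    rcases (hw ω).eq_or_lt with h' | h'
    · simp [← h']
    · exact (mul_lt_mul_of_pos_left (hc ω h') h').le
  rw [← Finset.sum_mul, hw1, one_mul] at this
  linarith

section

variable {R A B : Type*} [Fintype R] [Fintype A] [Fintype B] {M : ℕ}

/-- The average divergence from a fixed output law exceeds the mutual information by the divergence
of the averaged output from that law. The condition `hc` ensures absolute continuity. -/
theorem weightInfo_le_avg_divergence [NeZero M] {p : A → ℝ} (hp0 : ∀ a, 0 ≤ p a)
    (hp : ∑ a, p a = 1) {q : R → ℝ}
    (hq0 : ∀ r, 0 ≤ q r) (hq : ∑ r, q r = 1) {V : A → B → ℝ} (hV : IsKernel V)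
    {c : Fin M × R → A} (hc : ∀ j, 0 < p (c j)) :
    weightInfo (fun _ => (M : ℝ)⁻¹) (fun m b => ∑ r, q r * V (c (m, r)) b) ≤
      ∑ m, (M : ℝ)⁻¹ * ∑ b, (∑ r, q r * V (c (m, r)) b) *
        (log (∑ r, q r * V (c (m, r)) b) - log (∑ a, p a * V a b)) := by
  have hM : (0 : ℝ) < M := Nat.cast_pos.2 (Nat.pos_of_ne_zero (NeZero.ne M))
  have hMi : (0 : ℝ) ≤ (M : ℝ)⁻¹ := inv_nonneg.2 hM.le
  have hw : ∑ _m : Fin M, (M : ℝ)⁻¹ = 1 := by simp [hM.ne']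
  set P : Fin M → B → ℝ := fun m b => ∑ r, q r * V (c (m, r)) b with hP
  have hP0 : ∀ m b, 0 ≤ P m b := fun m b =>
    Finset.sum_nonneg fun r _ => mul_nonneg (hq0 r) (hV.nonneg _ _)
  have hP1 : ∀ m, ∑ b, P m b = 1 := fun m => by
    simp only [hP]
    rw [Finset.sum_comm]
    simp only [← Finset.mul_sum, hV.sum_eq_one, mul_one, hq]
  have hG := sum_mul_log_sub_log_nonneg (fun b => ∑ m, (M : ℝ)⁻¹ * P m b)
    (fun b => ∑ a, p a * V a b) (fun b => Finset.sum_nonneg fun m _ => mul_nonneg hMi (hP0 m b))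
    (fun b => Finset.sum_nonneg fun a _ => mul_nonneg (hp0 a) (hV.nonneg a b))
    (fun b h => by
      refine Finset.sum_eq_zero fun m _ => ?_
      have h0 : ∀ a, p a * V a b = 0 := fun a => (Finset.sum_eq_zero_iff_of_nonneg fun a _ =>
        mul_nonneg (hp0 a) (hV.nonneg a b)).1 h a (Finset.mem_univ a)
      have h1 : P m b = 0 := Finset.sum_eq_zero fun r _ => by
        rw [(mul_eq_zero.1 (h0 (c (m, r)))).resolve_left (hc _).ne', mul_zero]
      rw [h1, mul_zero])
    (by
      rw [sum_mul_kernel hV, hp, Finset.sum_comm]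
      simp only [← Finset.mul_sum, hP1, mul_one]
      exact hw.ge)
  rw [weightInfo_eq_sum_log hw]
  have e : ∑ m, (M : ℝ)⁻¹ * ∑ b, P m b * (log (P m b) - log (∑ a, p a * V a b)) =
      ∑ m, ∑ b, (M : ℝ)⁻¹ * P m b * (log (P m b) - log (∑ m, (M : ℝ)⁻¹ * P m b)) +
      ∑ b, (∑ m, (M : ℝ)⁻¹ * P m b) *
        (log (∑ m, (M : ℝ)⁻¹ * P m b) - log (∑ a, p a * V a b)) := by
    have e1 : ∑ b, (∑ m, (M : ℝ)⁻¹ * P m b) *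
        (log (∑ m, (M : ℝ)⁻¹ * P m b) - log (∑ a, p a * V a b)) =
        ∑ m, ∑ b, (M : ℝ)⁻¹ * P m b *
        (log (∑ m, (M : ℝ)⁻¹ * P m b) - log (∑ a, p a * V a b)) := by
      rw [Finset.sum_comm]
      exact Finset.sum_congr rfl fun b _ => by rw [Finset.sum_mul]
    rw [e1, ← Finset.sum_add_distrib]
    refine Finset.sum_congr rfl fun m _ => ?_
    rw [← Finset.sum_add_distrib, Finset.mul_sum]
    refine Finset.sum_congr rfl fun b _ => by ring
  linarith

open Classical in
/-- Random coding with time sharing: there is a codebook for which the sum of the probability of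
error and of the leakage is at most the expectation over the random codebook. -/
theorem exists_codebook [NeZero M] [Nonempty R] {U B' : Type*} [Fintype U] [Fintype B']
    {l : U → ℝ} (hl0 : ∀ u, 0 ≤ l u) (hl : ∑ u, l u = 1) {p : U → A → ℝ}
    (hp0 : ∀ u a, 0 ≤ p u a) (hp : ∀ u, ∑ a, p u a = 1) {q : R → ℝ} (hq0 : ∀ r, 0 ≤ q r)
    (hq : ∑ r, q r = 1) {V : A → B → ℝ} (hV : IsKernel V) {V' : A → B' → ℝ} (hV' : IsKernel V')
    {s : ℝ} (hs : 0 ≤ s) (hs1 : s ≤ 1) :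
    ∃ (c : Fin M × R → A) (f : B → Fin M),
      ∑ m, (M : ℝ)⁻¹ * ∑ b, (∑ r, q r * V (c (m, r)) b) * (if f b = m then 0 else 1) +
        weightInfo (fun _ => (M : ℝ)⁻¹) (fun m b => ∑ r, q r * V' (c (m, r)) b) ≤
      (M : ℝ) ^ s * (∑ r, q r ^ (1 - s)) *
        ∑ u, l u * ∑ a, ∑ b, p u a * (V a b ^ (1 - s) * (∑ a, p u a * V a b) ^ s) +
      ∑ r, q r * ∑ u, l u * ∑ a, ∑ b,
        p u a * V' a b * log (q r * (V' a b / ∑ a, p u a * V' a b) + (1 - q r)) := by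
  have hM : (0 : ℝ) < M := Nat.cast_pos.2 (Nat.pos_of_ne_zero (NeZero.ne M))
  have hMi : (0 : ℝ) ≤ (M : ℝ)⁻¹ := inv_nonneg.2 hM.le
  have hw : ∑ _m : Fin M, (M : ℝ)⁻¹ = 1 := by simp [hM.ne']
  set err : (Fin M × R → A) → ℝ := fun c =>
    ∑ m, (M : ℝ)⁻¹ * ∑ b, (∑ r, q r * V (c (m, r)) b) * (if mapDecoder q V c b = m then 0 else 1)
  set dv : U → (Fin M × R → A) → Fin M → ℝ := fun u c m =>
    ∑ b, (∑ r, q r * V' (c (m, r)) b) *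
        (log (∑ r, q r * V' (c (m, r)) b) - log (∑ a, p u a * V' a b))
  have hE := fun u => sum_codebook_error_le (hp0 u) (hp u) hq0 hq hV (M := M) hs hs1
  have hD := fun u m => sum_codebook_divergence_le (hp0 u) (hp u) hq0 hq hV' (M := M) m
  set ε₁ := fun u => ∑ a, ∑ b, p u a * (V a b ^ (1 - s) * (∑ a, p u a * V a b) ^ s)
  set ε₂ := fun u => ∑ r, q r * ∑ a, ∑ b,
        p u a * V' a b * log (q r * (V' a b / ∑ a, p u a * V' a b) + (1 - q r)) with hε₂
  have hsum : ∑ ω : U × (Fin M × R → A), (l ω.1 * ∏ j, p ω.1 (ω.2 j)) *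
      (err ω.2 + ∑ m, (M : ℝ)⁻¹ * dv ω.1 ω.2 m) ≤
      ∑ u, l u * ((M : ℝ) ^ s * (∑ r, q r ^ (1 - s)) * ε₁ u + ε₂ u) := by
    rw [Fintype.sum_prod_type]
    refine Finset.sum_le_sum fun u _ => ?_
    simp only [mul_assoc (l u), ← Finset.mul_sum]
    refine mul_le_mul_of_nonneg_left ?_ (hl0 u)
    simp only [mul_add, Finset.sum_add_distrib]
    refine add_le_add (hE u) ?_
    have e : ∑ c : Fin M × R → A, (∏ j, p u (c j)) * ((M : ℝ)⁻¹ * ∑ m, dv u c m) =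
        ∑ m, (M : ℝ)⁻¹ * ∑ c : Fin M × R → A, (∏ j, p u (c j)) * dv u c m := by
      simp only [Finset.mul_sum]
      rw [Finset.sum_comm]
      exact Finset.sum_congr rfl fun m _ => Finset.sum_congr rfl fun c _ => by ring
    rw [e]
    calc _ ≤ ∑ _m : Fin M, (M : ℝ)⁻¹ * ε₂ u :=
          Finset.sum_le_sum fun m _ => mul_le_mul_of_nonneg_left (hD u m) hMi
      _ = ε₂ u := by rw [← Finset.sum_mul, hw, one_mul]
  -- The time-sharing state is drawn together with the codebook, and error and leakage are
  -- controlled through their sum, so one selection suffices.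
  obtain ⟨⟨u, c⟩, hpos, hle⟩ := exists_le_of_sum_mul_le
    (fun ω => mul_nonneg (hl0 _) (Finset.prod_nonneg fun j _ => hp0 _ _))
    (by
      rw [Fintype.sum_prod_type]
      simp only [← Finset.mul_sum, sum_prod_weight (hp _), mul_one, hl]) hsum
  have hprod : ∏ j, p u (c j) ≠ 0 := (mul_ne_zero_iff.1 hpos.ne').2
  have hc : ∀ j, 0 < p u (c j) := fun j => (hp0 _ _).lt_of_ne' (Finset.prod_ne_zero_iff.1 hprod j
    (Finset.mem_univ j))
  refine ⟨c, mapDecoder q V c, ?_⟩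
  have hg := weightInfo_le_avg_divergence (hp0 u) (hp u) hq0 hq hV' hc
  have e3 : ∑ u, l u * ((M : ℝ) ^ s * (∑ r, q r ^ (1 - s)) * ε₁ u + ε₂ u) =
      (M : ℝ) ^ s * (∑ r, q r ^ (1 - s)) * ∑ u, l u * ε₁ u +
      ∑ r, q r * ∑ u, l u * ∑ a, ∑ b,
        p u a * V' a b * log (q r * (V' a b / ∑ a, p u a * V' a b) + (1 - q r)) := by
    simp only [mul_add, Finset.sum_add_distrib]
    congr 1
    · exact (Finset.sum_congr rfl fun u _ => by ring).trans (Finset.mul_sum _ _ _).symm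
    · simp only [hε₂, Finset.mul_sum]
      rw [Finset.sum_comm]
      refine Finset.sum_congr rfl fun r _ => Finset.sum_congr rfl fun u _ =>
        Finset.sum_congr rfl fun a _ => Finset.sum_congr rfl fun b _ => by ring
  rw [e3] at hle
  exact (add_le_add_right hg _).trans hle

end

/-! ### Tensorization and exponential bounds -/

theorem sum_sum_sum_prod {n : ℕ} {U A B : Type*} [Fintype U] [Fintype A] [Fintype B]
    (F : Fin n → U → A → B → ℝ) :
    ∑ u : Fin n → U, ∑ a : Fin n → A, ∑ b : Fin n → B, ∏ i, F i (u i) (a i) (b i) =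
      ∏ i, ∑ u, ∑ a, ∑ b, F i u a b := by
  rw [Fintype.prod_sum fun i u => ∑ a, ∑ b, F i u a b]
  refine Finset.sum_congr rfl fun u _ => ?_
  rw [Fintype.prod_sum fun i a => ∑ b, F i (u i) a b]
  refine Finset.sum_congr rfl fun a _ => ?_
  rw [Fintype.prod_sum fun i b => F i (u i) (a i) b]

theorem sum_sum_sum_prod_mul_sum {n : ℕ} {U A B : Type*} [Fintype U] [Fintype A] [Fintype B]
    {w : U → A → B → ℝ} (hw : ∑ u, ∑ a, ∑ b, w u a b = 1) (g : U → A → B → ℝ) :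
    ∑ u : Fin n → U, ∑ a : Fin n → A, ∑ b : Fin n → B,
      (∏ i, w (u i) (a i) (b i)) * ∑ i, g (u i) (a i) (b i) =
      n * ∑ u, ∑ a, ∑ b, w u a b * g u a b := by
  have h : ∀ i₀ : Fin n, ∑ u : Fin n → U, ∑ a : Fin n → A, ∑ b : Fin n → B,
      (∏ i, w (u i) (a i) (b i)) * g (u i₀) (a i₀) (b i₀) =
      ∑ u, ∑ a, ∑ b, w u a b * g u a b := by
    intro i₀
    have e : ∀ (u : Fin n → U) (a : Fin n → A) (b : Fin n → B),
        (∏ i, w (u i) (a i) (b i)) * g (u i₀) (a i₀) (b i₀) =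
        ∏ i, w (u i) (a i) (b i) * if i = i₀ then g (u i) (a i) (b i) else 1 := fun u a b => by
      rw [Finset.prod_mul_distrib, Finset.prod_ite_eq' Finset.univ i₀,
        if_pos (Finset.mem_univ _)]
    simp only [e]
    rw [sum_sum_sum_prod fun i u a b => w u a b * if i = i₀ then g u a b else 1,
      Finset.prod_eq_single i₀]
    · simp
    · intro i _ hi
      simp [hi, hw]
    · simp
  simp only [Finset.mul_sum]
  have h2 : ∑ u : Fin n → U, ∑ a : Fin n → A, ∑ b : Fin n → B, ∑ i₀,
      (∏ i, w (u i) (a i) (b i)) * g (u i₀) (a i₀) (b i₀) =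
      ∑ i₀, ∑ u : Fin n → U, ∑ a : Fin n → A, ∑ b : Fin n → B,
      (∏ i, w (u i) (a i) (b i)) * g (u i₀) (a i₀) (b i₀) := by
    rw [Finset.sum_comm (s := (Finset.univ : Finset (Fin n)))]
    refine Finset.sum_congr rfl fun u _ => ?_
    rw [Finset.sum_comm (s := (Finset.univ : Finset (Fin n)))]
    refine Finset.sum_congr rfl fun a _ => ?_
    rw [Finset.sum_comm (s := (Finset.univ : Finset (Fin n)))]
  rw [h2, Finset.sum_congr rfl fun i _ => h i]
  simp only [Finset.sum_const, Finset.card_univ, Fintype.card_fin, nsmul_eq_mul, Finset.mul_sum]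

/-- Second-order bound on the moments `E[aˢ]` of a positive random variable for small `s`. -/
theorem exists_sum_mul_rpow_le {Ω : Type*} [Fintype Ω] {w a : Ω → ℝ} (hw : ∀ ω, 0 ≤ w ω)
    (hw1 : ∑ ω, w ω = 1) (ha : ∀ ω, 0 < w ω → 0 < a ω) :
    ∃ C, 0 ≤ C ∧ ∃ s₀, 0 < s₀ ∧ ∀ s, |s| ≤ s₀ →
      ∑ ω, w ω * a ω ^ s ≤ exp (s * ∑ ω, w ω * log (a ω) + C * s ^ 2) := by
  set L := 1 + ∑ ω, |log (a ω)| with hL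
  have hLs : 0 ≤ ∑ ω, |log (a ω)| := Finset.sum_nonneg fun _ _ => abs_nonneg _
  have hL0 : 0 < L := by linarith
  have hlog : ∀ ω, |log (a ω)| ≤ L := fun ω => by
    have := Finset.single_le_sum (f := fun ω => |log (a ω)|) (fun _ _ => abs_nonneg _)
      (Finset.mem_univ ω)
    linarith
  -- For `|s| ≤ 1 / L` the exponent `s log a` lies in `[-1, 1]`, where `exp x ≤ 1 + x + x ^ 2`. The
  -- summand `1` in `L` keeps it positive.
  refine ⟨L ^ 2, sq_nonneg L, L⁻¹, inv_pos.2 hL0, fun s hs => ?_⟩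
  have hpt : ∀ ω, w ω * a ω ^ s ≤ w ω * (1 + s * log (a ω) + L ^ 2 * s ^ 2) := by
    intro ω
    rcases (hw ω).eq_or_lt with h | h
    · simp [← h]
    refine mul_le_mul_of_nonneg_left ?_ h.le
    have hx : |log (a ω) * s| ≤ 1 := by
      rw [abs_mul]
      calc |log (a ω)| * |s| ≤ L * L⁻¹ := by gcongr; exact hlog ω
        _ = 1 := mul_inv_cancel₀ hL0.ne'
    rw [rpow_def_of_pos (ha ω h)]
    have h1 := (abs_le.1 (Real.abs_exp_sub_one_sub_id_le hx)).2
    have h2 : (log (a ω) * s) ^ 2 ≤ L ^ 2 * s ^ 2 := by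
      rw [mul_pow]
      refine mul_le_mul_of_nonneg_right ?_ (sq_nonneg s)
      rw [← sq_abs]
      exact pow_le_pow_left₀ (abs_nonneg _) (hlog ω) 2
    linarith
  refine (Finset.sum_le_sum fun ω _ => hpt ω).trans ?_
  have e : ∑ ω, w ω * (1 + s * log (a ω) + L ^ 2 * s ^ 2) =
      (s * ∑ ω, w ω * log (a ω) + L ^ 2 * s ^ 2) + 1 := by
    simp only [mul_add, Finset.sum_add_distrib, mul_one, hw1, ← Finset.sum_mul, Finset.mul_sum,
      mul_left_comm s]
    ring
  rw [e]
  exact add_one_le_exp _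

section channel

variable {U A B : Type*} [Fintype U] [Fintype A] [Fintype B] {l : U → ℝ} (hl0 : ∀ u, 0 ≤ l u)
  (hl : ∑ u, l u = 1) {p : U → A → ℝ} (hp0 : ∀ u a, 0 ≤ p u a) (hp : ∀ u, ∑ a, p u a = 1)
  {V : A → B → ℝ} (hV : IsKernel V)

include hl0 hl hp0 hp hV

/-- Moments of the likelihood ratio between the channel and its output distribution. -/
theorem exists_sum_likelihood_rpow_le :
    ∃ C, 0 ≤ C ∧ ∃ s₀, 0 < s₀ ∧ ∀ s, |s| ≤ s₀ →
      ∑ u, ∑ a, ∑ b, l u * (p u a * V a b) * (V a b / ∑ a, p u a * V a b) ^ s ≤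
        exp (s * ∑ u, l u * weightInfo (p u) V + C * s ^ 2) := by
  obtain ⟨C, hC, s₀, hs₀, h⟩ := exists_sum_mul_rpow_le (Ω := U × A × B)
    (w := fun ω => l ω.1 * (p ω.1 ω.2.1 * V ω.2.1 ω.2.2))
    (a := fun ω => V ω.2.1 ω.2.2 / ∑ a, p ω.1 a * V a ω.2.2)
    (fun ω => mul_nonneg (hl0 _) (mul_nonneg (hp0 _ _) (hV.nonneg _ _)))
    (by simp only [Fintype.sum_prod_type, ← Finset.mul_sum, hV.sum_eq_one, mul_one, hp, hl])
    (fun ω hω => by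
      have h1 : 0 < p ω.1 ω.2.1 * V ω.2.1 ω.2.2 :=
        (mul_nonneg (hp0 _ _) (hV.nonneg _ _)).lt_of_ne' (mul_ne_zero_iff.1 hω.ne').2
      have h2 : 0 < V ω.2.1 ω.2.2 := (hV.nonneg _ _).lt_of_ne' (mul_ne_zero_iff.1 h1.ne').2
      exact div_pos h2 (h1.trans_le (Finset.single_le_sum (f := fun a => p ω.1 a * V a ω.2.2)
        (fun a _ => mul_nonneg (hp0 _ _) (hV.nonneg _ _)) (Finset.mem_univ _))))
  refine ⟨C, hC, s₀, hs₀, fun s hs => ?_⟩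
  have h' := h s hs
  simp only [Fintype.sum_prod_type] at h'
  refine h'.trans_eq ?_
  congr 3
  refine Finset.sum_congr rfl fun u _ => ?_
  rw [weightInfo_eq_sum_log (hp u), Finset.mul_sum]
  refine Finset.sum_congr rfl fun a _ => ?_
  rw [Finset.mul_sum]
  refine Finset.sum_congr rfl fun b _ => ?_
  rcases eq_or_ne (p u a * V a b) 0 with h0 | h0
  · simp [h0]
  have h1 : 0 < p u a * V a b := (mul_nonneg (hp0 _ _) (hV.nonneg _ _)).lt_of_ne' h0
  rw [log_div (mul_ne_zero_iff.1 h0).2 (h1.trans_le (Finset.single_le_sum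
    (f := fun a => p u a * V a b) (fun a _ => mul_nonneg (hp0 _ _) (hV.nonneg _ _))
    (Finset.mem_univ _))).ne', mul_assoc]

omit [Fintype U] hl0 hl hp in
theorem rpow_mul_rpow_le_likelihood {s : ℝ} (hs1 : s < 1) (u : U) (a : A) (b : B) :
    p u a * (V a b ^ (1 - s) * (∑ a, p u a * V a b) ^ s) =
      p u a * V a b * (V a b / ∑ a, p u a * V a b) ^ (-s) := by
  have hQ0 : 0 ≤ ∑ a, p u a * V a b :=
    Finset.sum_nonneg fun a _ => mul_nonneg (hp0 u a) (hV.nonneg a b)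
  rcases (hV.nonneg a b).eq_or_lt with h | h
  · rw [← h, zero_rpow (by linarith)]; simp
  rw [rpow_neg (div_nonneg h.le hQ0), div_rpow h.le hQ0, inv_div, rpow_sub h, rpow_one]
  have := (rpow_pos_of_pos h s).ne'
  field_simp

end channel

/-- Write `s log (1 + x) = log ((1 + x) ^ s) ≤ log (1 + x ^ s) ≤ x ^ s`. This turns the divergence
bound into a power moment, which factorizes over channel uses. -/
theorem log_one_add_le_rpow_div {x s : ℝ} (hx : 0 ≤ x) (hs : 0 < s) (hs1 : s ≤ 1) :
    log (1 + x) ≤ x ^ s / s := by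
  rw [le_div_iff₀ hs, mul_comm, ← log_rpow (by linarith)]
  have h1 : (1 + x) ^ s ≤ 1 + x ^ s := by
    have := Real.rpow_add_le_add_rpow zero_le_one hx hs.le hs1
    simpa using this
  have h2 : 0 ≤ x ^ s := rpow_nonneg hx s
  calc log ((1 + x) ^ s) ≤ log (1 + x ^ s) := log_le_log (rpow_pos_of_pos (by linarith) s) h1
    _ ≤ 1 + x ^ s - 1 := log_le_sub_one_of_pos (by linarith)
    _ = x ^ s := by ring

section memoryless

variable {U A B : Type*} [Fintype U] [Fintype A] [Fintype B] {l : U → ℝ} (hl0 : ∀ u, 0 ≤ l u)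
  (hl : ∑ u, l u = 1) {p : U → A → ℝ} (hp0 : ∀ u a, 0 ≤ p u a) (hp : ∀ u, ∑ a, p u a = 1)
  {V : A → B → ℝ} (hV : IsKernel V)

omit [Fintype U] [Fintype B] in
theorem sum_prod_mul_powKernel (p : U → A → ℝ) (V : A → B → ℝ) {n : ℕ} (u : Fin n → U)
    (b : Fin n → B) :
    ∑ a : Fin n → A, (∏ i, p (u i) (a i)) * powKernel n V a b =
      ∏ i, ∑ a, p (u i) a * V a (b i) := by
  rw [Fintype.prod_sum fun i a => p (u i) a * V a (b i)]
  simp only [powKernel, Finset.prod_mul_distrib]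

include hp0 hV

theorem sum_memoryless_likelihood_rpow (n : ℕ) (s : ℝ) :
    ∑ u : Fin n → U, ∑ a : Fin n → A, ∑ b : Fin n → B, (∏ i, l (u i)) *
      ((∏ i, p (u i) (a i)) * powKernel n V a b) *
        (powKernel n V a b / ∑ a : Fin n → A, (∏ i, p (u i) (a i)) * powKernel n V a b) ^ s =
      (∑ u, ∑ a, ∑ b, l u * (p u a * V a b) * (V a b / ∑ a, p u a * V a b) ^ s) ^ n := by
  rw [← Fin.prod_const, ← sum_sum_sum_prod]
  refine Finset.sum_congr rfl fun u _ => Finset.sum_congr rfl fun a _ =>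
    Finset.sum_congr rfl fun b _ => ?_
  rw [sum_prod_mul_powKernel, powKernel, ← Finset.prod_div_distrib, ← Real.finsetProd_rpow]
  · simp only [Finset.prod_mul_distrib]
  · exact fun i _ => div_nonneg (hV.nonneg _ _) (Finset.sum_nonneg fun a _ =>
      mul_nonneg (hp0 _ _) (hV.nonneg _ _))

include hl0 in
-- Since `q ≤ 1`, the logarithm is at most `log (1 + q x)`, where `x` is the likelihood ratio, hence
-- at most `(q x) ^ s / s`.
theorem sum_memoryless_divergence_le {R : Type*} [Fintype R] {q : R → ℝ} (hq0 : ∀ r, 0 ≤ q r)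
    (hq : ∑ r, q r = 1) (n : ℕ) {s : ℝ} (hs : 0 < s) (hs1 : s ≤ 1) :
    ∑ r, q r * ∑ u : Fin n → U, (∏ i, l (u i)) * ∑ a : Fin n → A, ∑ b : Fin n → B,
        (∏ i, p (u i) (a i)) * powKernel n V a b *
        log (q r * (powKernel n V a b /
          ∑ a : Fin n → A, (∏ i, p (u i) (a i)) * powKernel n V a b) + (1 - q r)) ≤
      s⁻¹ * (∑ r, q r ^ (1 + s)) *
        (∑ u, ∑ a, ∑ b, l u * (p u a * V a b) * (V a b / ∑ a, p u a * V a b) ^ s) ^ n := by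
  have hq1 : ∀ r, q r ≤ 1 := fun r => hq ▸ Finset.single_le_sum (fun r _ => hq0 r)
    (Finset.mem_univ r)
  rw [← sum_memoryless_likelihood_rpow hp0 hV n s, Finset.mul_sum _ _ s⁻¹, Finset.sum_mul]
  refine Finset.sum_le_sum fun r _ => ?_
  have e : q r ^ (1 + s) = q r * q r ^ s := by
    rw [rpow_add_of_nonneg (hq0 r) zero_le_one hs.le, rpow_one]
  rw [e, mul_left_comm s⁻¹, mul_assoc (q r)]
  refine mul_le_mul_of_nonneg_left ?_ (hq0 r)
  simp only [Finset.mul_sum]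
  refine Finset.sum_le_sum fun u _ => Finset.sum_le_sum fun a _ => Finset.sum_le_sum fun b _ => ?_
  have hk := (hV.pow n).nonneg a b
  have hpn : 0 ≤ ∏ i, p (u i) (a i) := Finset.prod_nonneg fun i _ => hp0 _ _
  have hln : 0 ≤ ∏ i, l (u i) := Finset.prod_nonneg fun i _ => hl0 _
  have hx : 0 ≤ powKernel n V a b / ∑ a : Fin n → A, (∏ i, p (u i) (a i)) * powKernel n V a b :=
    div_nonneg hk (Finset.sum_nonneg fun a _ =>
      mul_nonneg (Finset.prod_nonneg fun i _ => hp0 _ _) ((hV.pow n).nonneg a b))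
  set x := powKernel n V a b / ∑ a : Fin n → A, (∏ i, p (u i) (a i)) * powKernel n V a b
  have h1 : log (q r * x + (1 - q r)) ≤ (q r * x) ^ s / s := by
    refine le_trans ?_ (log_one_add_le_rpow_div (mul_nonneg (hq0 r) hx) hs hs1)
    have h2 : 0 ≤ q r * x := mul_nonneg (hq0 r) hx
    have h3 := hq1 r
    rcases (add_nonneg h2 (sub_nonneg.2 h3)).eq_or_lt with h | h
    · rw [← h, log_zero]
      exact log_nonneg (by linarith)
    · exact log_le_log h (by linarith [hq0 r])
  rw [mul_rpow (hq0 r) hx] at h1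
  calc _ ≤ (∏ i, l (u i)) * ((∏ i, p (u i) (a i)) * powKernel n V a b * (q r ^ s * x ^ s / s)) := by
        gcongr
    _ = _ := by ring

include hl hp in
-- The value of the divergence bound without randomness. It settles the boundary case `I(X;Z|U) =
-- 0`, where the power moment bound need not decay.
theorem sum_memoryless_divergence_eq (n : ℕ) :
    ∑ u : Fin n → U, (∏ i, l (u i)) * ∑ a : Fin n → A, ∑ b : Fin n → B,
        (∏ i, p (u i) (a i)) * powKernel n V a b *
        log (powKernel n V a b /
          ∑ a : Fin n → A, (∏ i, p (u i) (a i)) * powKernel n V a b) =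
      n * ∑ u, l u * weightInfo (p u) V := by
  have hw : ∑ u, ∑ a, ∑ b, l u * (p u a * V a b) = 1 := by
    simp only [← Finset.mul_sum, hV.sum_eq_one, mul_one, hp, hl]
  have h := sum_sum_sum_prod_mul_sum (n := n) hw
    fun u a b => log (V a b) - log (∑ a, p u a * V a b)
  have e : ∑ u, ∑ a, ∑ b, l u * (p u a * V a b) * (log (V a b) - log (∑ a, p u a * V a b)) =
      ∑ u, l u * weightInfo (p u) V := by
    refine Finset.sum_congr rfl fun u _ => ?_
    rw [weightInfo_eq_sum_log (hp u)]
    simp only [Finset.mul_sum, mul_assoc]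
  rw [← e, ← h]
  refine Finset.sum_congr rfl fun u _ => ?_
  rw [Finset.mul_sum]
  refine Finset.sum_congr rfl fun a _ => ?_
  rw [Finset.mul_sum]
  refine Finset.sum_congr rfl fun b _ => ?_
  rw [sum_prod_mul_powKernel, powKernel, ← Finset.prod_div_distrib]
  simp only [Finset.prod_mul_distrib]
  rcases eq_or_ne ((∏ i, p (u i) (a i)) * ∏ i, V (a i) (b i)) 0 with h0 | h0
  · simp [h0]
  rw [← mul_assoc, log_prod]
  · congr 1
    refine Finset.sum_congr rfl fun i _ => ?_
    have hp' := Finset.prod_ne_zero_iff.1 (mul_ne_zero_iff.1 h0).1 i (Finset.mem_univ _)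
    have hV' := Finset.prod_ne_zero_iff.1 (mul_ne_zero_iff.1 h0).2 i (Finset.mem_univ _)
    have h1 : 0 < p (u i) (a i) * V (a i) (b i) :=
      (mul_nonneg (hp0 _ _) (hV.nonneg _ _)).lt_of_ne' (mul_ne_zero hp' hV')
    rw [log_div hV' (h1.trans_le (Finset.single_le_sum (f := fun a => p (u i) a * V a (b i))
      (fun a _ => mul_nonneg (hp0 _ _) (hV.nonneg _ _)) (Finset.mem_univ _))).ne']
  · intro i _
    have hp' := Finset.prod_ne_zero_iff.1 (mul_ne_zero_iff.1 h0).1 i (Finset.mem_univ _)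
    have hV' := Finset.prod_ne_zero_iff.1 (mul_ne_zero_iff.1 h0).2 i (Finset.mem_univ _)
    have h1 : 0 < p (u i) (a i) * V (a i) (b i) :=
      (mul_nonneg (hp0 _ _) (hV.nonneg _ _)).lt_of_ne' (mul_ne_zero hp' hV')
    exact div_ne_zero hV' (h1.trans_le (Finset.single_le_sum (f := fun a => p (u i) a * V a (b i))
      (fun a _ => mul_nonneg (hp0 _ _) (hV.nonneg _ _)) (Finset.mem_univ _))).ne'

end memoryless

/-! ### Achievability -/

section achievability

variable {S S' X Y Z : Type*}

/-- The source whose first `k` symbols have law `q` and whose other symbols are constant. -/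
noncomputable def truncatedSource (q : PMF S') (r₀ : S') (k n : ℕ) : Fin n → PMF S' :=
  fun i => if (i : ℕ) < k then q else PMF.pure r₀

theorem sum_truncatedSource_rpow [Fintype S'] (q : PMF S') (r₀ : S') {k n : ℕ} (hk : k ≤ n)
    {x : ℝ} (hx : x ≠ 0) :
    ∑ r, (productPMF (truncatedSource q r₀ k n) r).toReal ^ x = (∑ r, (q r).toReal ^ x) ^ k := by
  classical
  have h1 : ∀ r : Fin n → S', (productPMF (truncatedSource q r₀ k n) r).toReal ^ x =
      ∏ i, (truncatedSource q r₀ k n i (r i)).toReal ^ x := fun r => by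
    rw [productPMF_apply, ENNReal.toReal_prod, Real.finsetProd_rpow]
    exact fun i _ => ENNReal.toReal_nonneg
  simp only [h1]
  rw [← Fintype.prod_sum fun i r => (truncatedSource q r₀ k n i r).toReal ^ x]
  have h2 : ∀ i : Fin n, ∑ r, (truncatedSource q r₀ k n i r).toReal ^ x =
      if (i : ℕ) < k then ∑ r, (q r).toReal ^ x else 1 := fun i => by
    unfold truncatedSource
    split_ifs with h
    · rfl
    · rw [Finset.sum_eq_single r₀]
      · simp
      · intro r _ hr
        simp [PMF.pure_apply, hr, zero_rpow hx]
      · simp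
  simp only [h2]
  rw [Finset.prod_ite, Finset.prod_const, Finset.prod_const_one, mul_one, Fin.card_filter_val_lt,
    min_eq_right hk]

theorem truncatedSource_zero_apply (q : PMF S') (r₀ : S') (n : ℕ) (r : Fin n → S') :
    (productPMF (truncatedSource q r₀ 0 n) r).toReal = 0 ∨
      (productPMF (truncatedSource q r₀ 0 n) r).toReal = 1 := by
  classical
  by_cases h : ∀ i, r i = r₀
  · right
    simp [productPMF_apply, truncatedSource, h]
  · left
    push Not at h
    obtain ⟨i, hi⟩ := h
    rw [productPMF_apply, Finset.prod_eq_zero (Finset.mem_univ i)]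
    · simp
    · simp [truncatedSource, PMF.pure_apply, hi]

/-- The code that draws the codeword from a codebook, as a function of the first `k` source
symbols. -/
def codebookCode {M n : ℕ} (g : S → S') (r₀ : S') (k : ℕ) (c : Fin M × (Fin n → S') → Fin n → X)
    (f : (Fin n → Y) → Fin M) : Code S X Y M n where
  enc m s := c (m, fun i => if (i : ℕ) < k then g (s i) else r₀)
  dec y := some (f y)

theorem kernel_codebookCode [Fintype S'] [Fintype X] {O : Type*} {M n : ℕ} (g : S → S') (r₀ : S')
    (k : ℕ) (c : Fin M × (Fin n → S') → Fin n → X) (f : (Fin n → Y) → Fin M) (pS : PMF S)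
    (V : X → O → ℝ) (m : Fin M) (o : Fin n → O) :
    (codebookCode g r₀ k c f).kernel pS V m o =
      ∑ r, (productPMF (truncatedSource (pS.map g) r₀ k n) r).toReal *
        powKernel n V (c (m, r)) o := by
  classical
  have h : (codebookCode g r₀ k c f).inputLaw pS m =
      (productPMF (truncatedSource (pS.map g) r₀ k n)).map fun r => c (m, r) := by
    have h1 : (productPMF fun _ : Fin n => pS).map
        (fun (s : Fin n → S) (i : Fin n) => if (i : ℕ) < k then g (s i) else r₀) =
        productPMF (truncatedSource (pS.map g) r₀ k n) := by
      rw [productPMF_map (fun _ : Fin n => pS) fun i a => if (i : ℕ) < k then g a else r₀]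
      congr 1
      funext i
      unfold truncatedSource
      split_ifs
      · rfl
      · exact PMF.map_const _ _
    rw [← h1, PMF.map_comp]
    rfl
  unfold Code.kernel
  rw [h]
  simp only [toReal_map_apply, Finset.sum_mul]
  rw [Finset.sum_comm]
  refine Finset.sum_congr rfl fun r _ => ?_
  simp [ite_mul]

variable [Fintype X] [Fintype Y] [Fintype Z]

/-- `E` is the divergence part of the random coding bound. It is kept abstract so that it can be
estimated by the power moment or, for `k = 0`, evaluated exactly. -/
theorem exists_code [Fintype S'] {M n k : ℕ} [NeZero M] (W : X → PMF (Y × Z)) (pS : PMF S)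
    (g : S → S') (r₀ : S') (hk : k ≤ n) {U : Type*} [Fintype U] {l : U → ℝ} (hl0 : ∀ u, 0 ≤ l u)
    (hl : ∑ u, l u = 1) {p : U → X → ℝ} (hp0 : ∀ u a, 0 ≤ p u a) (hp : ∀ u, ∑ a, p u a = 1)
    {s : ℝ} (hs : 0 < s) (hs1 : s < 1) :
    ∃ C : Code S X Y M n, ∃ E, C.errorProb W pS + C.leakage W pS * log 2 ≤
      (M : ℝ) ^ s * (∑ r, (pS.map g r).toReal ^ (1 - s)) ^ k *
        (∑ u, ∑ a, ∑ b, l u * (p u a * out W Prod.fst a b) *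
          (out W Prod.fst a b / ∑ a, p u a * out W Prod.fst a b) ^ (-s)) ^ n + E ∧
      E ≤ s⁻¹ * (∑ r, (pS.map g r).toReal ^ (1 + s)) ^ k *
        (∑ u, ∑ a, ∑ b, l u * (p u a * out W Prod.snd a b) *
          (out W Prod.snd a b / ∑ a, p u a * out W Prod.snd a b) ^ s) ^ n ∧
      (k = 0 → E = n * ∑ u, l u * weightInfo (p u) (out W Prod.snd)) := by
  classical
  have kY := isKernel_out W Prod.fst
  have kZ := isKernel_out W Prod.snd
  set VY := out W Prod.fst
  set VZ := out W Prod.snd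
  have : Nonempty (Fin n → S') := ⟨fun _ => r₀⟩
  set q : (Fin n → S') → ℝ := fun r =>
    (productPMF (truncatedSource (pS.map g) r₀ k n) r).toReal with hqdef
  have hq0 : ∀ r, 0 ≤ q r := fun r => ENNReal.toReal_nonneg
  have hq : ∑ r, q r = 1 := PMF_sum_toReal _
  have hln : ∑ u : Fin n → U, ∏ i, l (u i) = 1 := sum_prod_weight hl
  have hpn : ∀ u : Fin n → U, ∑ a : Fin n → X, ∏ i, p (u i) (a i) = 1 := fun u => by
    rw [← Fintype.prod_sum fun i a => p (u i) a]
    simp [hp]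
  obtain ⟨c, f, h⟩ := exists_codebook (M := M) (l := fun u : Fin n → U => ∏ i, l (u i))
    (fun u => Finset.prod_nonneg fun i _ => hl0 _) hln
    (p := fun u a => ∏ i, p (u i) (a i)) (fun u a => Finset.prod_nonneg fun i _ => hp0 _ _) hpn
    hq0 hq (kY.pow n) (kZ.pow n) hs.le hs1.le
  refine ⟨codebookCode g r₀ k c f, _, le_of_eq_of_le ?_ (h.trans_eq (congrArg (· + _) ?_)), ?_, ?_⟩
  · rw [Code.errorProb_eq, Code.leakage_eq, div_mul_cancel₀ _ (log_pos one_lt_two).ne']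
    have e : (codebookCode g r₀ k c f).kernel pS VZ =
        fun m b => ∑ r, q r * powKernel n VZ (c (m, r)) b := by
      funext m b
      exact kernel_codebookCode g r₀ k c f pS VZ m b
    have e' : (codebookCode g r₀ k c f).kernel pS VY =
        fun m b => ∑ r, q r * powKernel n VY (c (m, r)) b := by
      funext m b
      exact kernel_codebookCode g r₀ k c f pS VY m b
    rw [e, e']
    simp only [codebookCode, Option.some_inj]
  · rw [hqdef, sum_truncatedSource_rpow _ _ hk (by linarith),
      ← sum_memoryless_likelihood_rpow hp0 kY n (-s)]
    congr 1
    refine Finset.sum_congr rfl fun u _ => ?_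
    rw [Finset.mul_sum]
    refine Finset.sum_congr rfl fun a _ => ?_
    rw [Finset.mul_sum]
    refine Finset.sum_congr rfl fun b _ => ?_
    rw [rpow_mul_rpow_le_likelihood
      (p := fun (u : Fin n → U) (a : Fin n → X) => ∏ i, p (u i) (a i))
      (fun u a => Finset.prod_nonneg fun i _ => hp0 _ _) (kY.pow n) hs1]
    ring
  · have h1 := sum_memoryless_divergence_le hl0 hp0 kZ hq0 hq n hs hs1.le
    rw [hqdef, sum_truncatedSource_rpow _ _ hk (by linarith)] at h1
    exact h1
  · rintro rfl
    have h01 : ∀ r, q r = 0 ∨ q r = 1 := truncatedSource_zero_apply _ _ _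
    have h1 : ∀ F : ℝ → ℝ, ∑ r, q r * F (q r) = F 1 := fun F => by
      have : ∀ r, q r * F (q r) = q r * F 1 := fun r => by
        rcases h01 r with h | h <;> simp [h]
      simp only [this, ← Finset.sum_mul, hq, one_mul]
    rw [h1 fun x => ∑ u : Fin n → U, (∏ i, l (u i)) * ∑ a : Fin n → X, ∑ b : Fin n → Z,
        (∏ i, p (u i) (a i)) * powKernel n VZ a b *
        log (x * (powKernel n VZ a b /
          ∑ a : Fin n → X, (∏ i, p (u i) (a i)) * powKernel n VZ a b) + (1 - x))]
    simp only [one_mul, sub_self, add_zero]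
    exact sum_memoryless_divergence_eq hl hp0 hp kZ n

theorem Code.leakage_nonneg {M n : ℕ} [NeZero M] (C : Code S X Y M n) (W : X → PMF (Y × Z))
    (pS : PMF S) : 0 ≤ C.leakage W pS := by
  rw [C.leakage_eq]
  exact div_nonneg (weightInfo_nonneg _ (fun _ => inv_nonneg.2 (Nat.cast_nonneg _))
    (C.isKernel_kernel pS (isKernel_out W _))) (log_pos one_lt_two).le

theorem numMessages_le {R : ℝ} (hR : 0 ≤ R) (n : ℕ) :
    (numMessages R n : ℝ) ≤ 2 * exp (n * (R * log 2)) := by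
  have h1 : (2 : ℝ) ^ ((n : ℝ) * R) = exp (n * (R * log 2)) := by
    rw [rpow_def_of_pos two_pos]
    congr 1
    ring
  have h2 : 1 ≤ exp (n * (R * log 2)) := one_le_exp (by
    have := log_pos one_lt_two
    positivity)
  have h3 := (Nat.ceil_lt_add_one (exp_pos (n * (R * log 2))).le).le
  rw [numMessages, h1]
  linarith

/-- The code uses `⌊t n⌋` quantized source symbols. `hY` lets the receiver decode message and
randomness together; `hZ` makes the randomness saturate the eavesdropper's channel, or says that
this channel carries no information. -/
theorem achievable_of_rates [Fintype S'] (W : X → PMF (Y × Z)) (pS : PMF S) (g : S → S')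
    (r₀ : S') {U : Type*} [Fintype U] {l : U → ℝ} (hl0 : ∀ u, 0 ≤ l u) (hl : ∑ u, l u = 1)
    {p : U → X → ℝ} (hp0 : ∀ u a, 0 ≤ p u a) (hp : ∀ u, ∑ a, p u a = 1) {R t : ℝ} (hR : 0 ≤ R)
    (ht : 0 ≤ t) (ht1 : t ≤ 1)
    (hY : R * log 2 + t * ∑ r, negMulLog (pS.map g r).toReal <
      ∑ u, l u * weightInfo (p u) (out W Prod.fst))
    (hZ : ∑ u, l u * weightInfo (p u) (out W Prod.snd) < t * ∑ r, negMulLog (pS.map g r).toReal ∨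
      t = 0 ∧ ∑ u, l u * weightInfo (p u) (out W Prod.snd) = 0) :
    Achievable W pS R := by
  set h := ∑ r, negMulLog (pS.map g r).toReal with hh
  set IY := ∑ u, l u * weightInfo (p u) (out W Prod.fst)
  set IZ := ∑ u, l u * weightInfo (p u) (out W Prod.snd)
  have hh0 : 0 ≤ h := Finset.sum_nonneg fun r _ => negMulLog_nonneg ENNReal.toReal_nonneg
    (ENNReal.toReal_le_of_le_ofReal zero_le_one
      ((PMF.coe_le_one _ r).trans_eq ENNReal.ofReal_one.symm))
  obtain ⟨CY, hCY, sY, hsY, bY⟩ := exists_sum_likelihood_rpow_le hl0 hl hp0 hp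
    (isKernel_out W Prod.fst)
  obtain ⟨CZ, hCZ, sZ, hsZ, bZ⟩ := exists_sum_likelihood_rpow_le hl0 hl hp0 hp
    (isKernel_out W Prod.snd)
  obtain ⟨Cq, hCq, sq, hsq, bq⟩ := exists_sum_mul_rpow_le (w := fun r => (pS.map g r).toReal)
    (a := fun r => (pS.map g r).toReal) (fun r => ENNReal.toReal_nonneg) (PMF_sum_toReal _)
    (fun r hr => hr)
  have hqlog : ∑ r, (pS.map g r).toReal * log (pS.map g r).toReal = -h := by
    rw [hh, ← Finset.sum_neg_distrib]
    exact Finset.sum_congr rfl fun r _ => by rw [negMulLog]; ring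
  rw [hqlog] at bq
  set C := CY + CZ + Cq with hC
  have hsmall : ∀ δ : ℝ, 0 < δ → ∀ᶠ s in 𝓝[>] (0 : ℝ), C * s < δ := fun δ hδ => by
    have : Tendsto (fun s : ℝ => C * s) (𝓝[>] 0) (𝓝 (C * 0)) :=
      ((continuous_const_mul C).tendsto 0).mono_left nhdsWithin_le_nhds
    rw [mul_zero] at this
    exact this.eventually_lt_const hδ
  -- One `s` so small that the quadratic corrections `C * s ^ 2` stay below the linear gains given
  -- by the strict rate inequalities.
  obtain ⟨s, hs0, hs1, hsY', hsZ', hsq', hs5, hs6⟩ : ∃ s : ℝ, 0 < s ∧ s < 1 ∧ s < sY ∧ s < sZ ∧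
      s < sq ∧ C * s < IY - (R * log 2 + t * h) ∧ (IZ < t * h → C * s < t * h - IZ) := by
    have e6 : ∀ᶠ s in 𝓝[>] (0 : ℝ), IZ < t * h → C * s < t * h - IZ := by
      by_cases hc : IZ < t * h
      · filter_upwards [hsmall _ (sub_pos.2 hc)] with s hs _ using hs
      · exact Eventually.of_forall fun s hs => absurd hs hc
    have lt : ∀ a : ℝ, 0 < a → ∀ᶠ s in 𝓝[>] (0 : ℝ), s < a := fun a ha =>
      nhdsWithin_le_nhds (gt_mem_nhds ha)
    exact (((eventually_mem_nhdsWithin (a := (0 : ℝ)) (s := Set.Ioi 0)).and <|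
      (lt 1 one_pos).and <| (lt sY hsY).and <| (lt sZ hsZ).and <| (lt sq hsq).and <|
      (hsmall _ (sub_pos.2 hY)).and e6)).exists
  have k_le : ∀ n : ℕ, ⌊t * n⌋₊ ≤ n := fun n =>
    Nat.floor_le_of_le (mul_le_of_le_one_left (Nat.cast_nonneg n) ht1)
  have hk1 : ∀ n : ℕ, (⌊t * n⌋₊ : ℝ) ≤ t * n := fun n =>
    Nat.floor_le (mul_nonneg ht (Nat.cast_nonneg n))
  -- The upper bound on the floor serves decoding, the lower one secrecy; rounding costs the latter
  -- a constant factor `exp (s * h)`.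
  have hk2 : ∀ n : ℕ, t * n - 1 ≤ (⌊t * n⌋₊ : ℝ) := fun n => (Nat.sub_one_lt_floor _).le
  have hk3 : ∀ n : ℕ, (⌊t * n⌋₊ : ℝ) ≤ n := fun n => Nat.cast_le.2 (k_le n)
  choose D E hD hE hE0 using fun n : ℕ =>
    exists_code (M := numMessages R n) W pS g r₀ (k_le n) hl0 hl hp0 hp hs0 hs1
  set y₁ := s * (R * log 2 + t * h - IY) + C * s ^ 2 with hy₁
  have hy₁0 : y₁ < 0 := by nlinarith
  have hs2 : 0 ≤ s ^ 2 := sq_nonneg s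
  have b1 : ∀ n : ℕ, (numMessages R n : ℝ) ^ s *
      (∑ r, (pS.map g r).toReal ^ (1 - s)) ^ ⌊t * n⌋₊ *
        (∑ u, ∑ a, ∑ b, l u * (p u a * out W Prod.fst a b) *
          (out W Prod.fst a b / ∑ a, p u a * out W Prod.fst a b) ^ (-s)) ^ n ≤
      2 * exp y₁ ^ n := by
    intro n
    have f1 : (numMessages R n : ℝ) ^ s ≤ 2 * exp (n * (s * (R * log 2))) := by
      calc (numMessages R n : ℝ) ^ s ≤ (2 * exp (n * (R * log 2))) ^ s :=
            rpow_le_rpow (Nat.cast_nonneg _) (numMessages_le hR n) hs0.le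
        _ = 2 ^ s * exp (n * (s * (R * log 2))) := by
            rw [mul_rpow two_pos.le (exp_pos _).le, ← exp_mul]
            congr 2
            ring
        _ ≤ 2 ^ (1 : ℝ) * exp (n * (s * (R * log 2))) := by
            gcongr
            norm_num
        _ = _ := by rw [rpow_one]
    have f2 : (∑ r, (pS.map g r).toReal ^ (1 - s)) ^ ⌊t * n⌋₊ ≤
        exp (n * (s * (t * h) + Cq * s ^ 2)) := by
      have e : ∑ r, (pS.map g r).toReal ^ (1 - s) =
          ∑ r, (pS.map g r).toReal * (pS.map g r).toReal ^ (-s) :=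
        Finset.sum_congr rfl fun r _ => by
          rcases (ENNReal.toReal_nonneg (a := pS.map g r)).eq_or_lt with h0 | h0
          · rw [← h0, zero_rpow (by linarith), zero_mul]
          · rw [sub_eq_add_neg, rpow_add h0, rpow_one]
      rw [e]
      calc _ ≤ exp (-s * -h + Cq * (-s) ^ 2) ^ ⌊t * n⌋₊ := by
            gcongr
            exact bq (-s) (by rw [abs_neg, abs_of_pos hs0]; exact hsq'.le)
        _ = exp (⌊t * n⌋₊ * (s * h) + ⌊t * n⌋₊ * (Cq * s ^ 2)) := by
            rw [← exp_nat_mul]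
            congr 1
            ring
        _ ≤ exp (t * n * (s * h) + n * (Cq * s ^ 2)) := by
            gcongr
            · exact hk1 n
            · exact k_le n
        _ = _ := by congr 1; ring
    have f3 : (∑ u, ∑ a, ∑ b, l u * (p u a * out W Prod.fst a b) *
          (out W Prod.fst a b / ∑ a, p u a * out W Prod.fst a b) ^ (-s)) ^ n ≤
        exp (n * (-s * IY + CY * s ^ 2)) := by
      rw [exp_nat_mul]
      gcongr
      · exact Finset.sum_nonneg fun u _ => Finset.sum_nonneg fun a _ => Finset.sum_nonneg fun b _ =>
          mul_nonneg (mul_nonneg (hl0 _) (mul_nonneg (hp0 _ _) ((isKernel_out W _).nonneg _ _)))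
            (rpow_nonneg (div_nonneg ((isKernel_out W _).nonneg _ _) (Finset.sum_nonneg fun a _ =>
              mul_nonneg (hp0 _ _) ((isKernel_out W _).nonneg _ _))) _)
      · have := bY (-s) (by rw [abs_neg, abs_of_pos hs0]; exact hsY'.le)
        rwa [neg_sq] at this
    calc _ ≤ 2 * exp (n * (s * (R * log 2))) * exp (n * (s * (t * h) + Cq * s ^ 2)) *
          exp (n * (-s * IY + CY * s ^ 2)) := by
          have z2 : 0 ≤ ∑ r, (pS.map g r).toReal ^ (1 - s) :=
            Finset.sum_nonneg fun r _ => rpow_nonneg ENNReal.toReal_nonneg _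
          have z3 : 0 ≤ ∑ u, ∑ a, ∑ b, l u * (p u a * out W Prod.fst a b) *
              (out W Prod.fst a b / ∑ a, p u a * out W Prod.fst a b) ^ (-s) :=
            Finset.sum_nonneg fun u _ => Finset.sum_nonneg fun a _ => Finset.sum_nonneg fun b _ =>
            mul_nonneg (mul_nonneg (hl0 _) (mul_nonneg (hp0 _ _) ((isKernel_out W _).nonneg _ _)))
              (rpow_nonneg (div_nonneg ((isKernel_out W _).nonneg _ _)
                (Finset.sum_nonneg fun a _ =>
                mul_nonneg (hp0 _ _) ((isKernel_out W _).nonneg _ _))) _)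
          exact mul_le_mul (mul_le_mul f1 f2 (pow_nonneg z2 _) (by positivity)) f3
            (pow_nonneg z3 _) (by positivity)
      _ = 2 * exp (n * (s * (R * log 2) + (s * (t * h) + Cq * s ^ 2) +
          (-s * IY + CY * s ^ 2))) := by
          rw [mul_assoc, mul_assoc, ← exp_add, ← exp_add]
          congr 2
          ring
      _ ≤ 2 * exp (n * y₁) := by
          gcongr
          rw [hy₁, hC]
          nlinarith [mul_nonneg hCZ hs2]
      _ = _ := by rw [exp_nat_mul]
  have b2 : ∃ K y : ℝ, y < 0 ∧ ∀ n, E n ≤ K * exp y ^ n := by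
    rcases hZ with hZ | ⟨rfl, hZ⟩
    · refine ⟨s⁻¹ * exp (s * h), s * (IZ - t * h) + C * s ^ 2, by nlinarith [hs6 hZ], fun n => ?_⟩
      refine (hE n).trans ?_
      have f2 : (∑ r, (pS.map g r).toReal ^ (1 + s)) ^ ⌊t * n⌋₊ ≤
          exp (s * h) * exp (n * (-(s * (t * h)) + Cq * s ^ 2)) := by
        have e : ∑ r, (pS.map g r).toReal ^ (1 + s) =
            ∑ r, (pS.map g r).toReal * (pS.map g r).toReal ^ s :=
          Finset.sum_congr rfl fun r _ => by
            rw [rpow_add_of_nonneg ENNReal.toReal_nonneg zero_le_one hs0.le, rpow_one]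
        rw [e]
        calc _ ≤ exp (s * -h + Cq * s ^ 2) ^ ⌊t * n⌋₊ := by
              gcongr
              exact bq s (by rw [abs_of_pos hs0]; exact hsq'.le)
          _ = exp (-(⌊t * n⌋₊ * (s * h)) + ⌊t * n⌋₊ * (Cq * s ^ 2)) := by
              rw [← exp_nat_mul]
              congr 1
              ring
          _ ≤ exp (-((t * n - 1) * (s * h)) + n * (Cq * s ^ 2)) := by
              gcongr
              · exact hk2 n
              · exact k_le n
          _ = _ := by rw [← exp_add]; congr 1; ring
      have f3 : (∑ u, ∑ a, ∑ b, l u * (p u a * out W Prod.snd a b) *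
            (out W Prod.snd a b / ∑ a, p u a * out W Prod.snd a b) ^ s) ^ n ≤
          exp (n * (s * IZ + CZ * s ^ 2)) := by
        rw [exp_nat_mul]
        gcongr
        · exact Finset.sum_nonneg fun u _ => Finset.sum_nonneg fun a _ =>
            Finset.sum_nonneg fun b _ =>
            mul_nonneg (mul_nonneg (hl0 _) (mul_nonneg (hp0 _ _) ((isKernel_out W _).nonneg _ _)))
              (rpow_nonneg (div_nonneg ((isKernel_out W _).nonneg _ _) (Finset.sum_nonneg
                fun a _ => mul_nonneg (hp0 _ _) ((isKernel_out W _).nonneg _ _))) _)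
        · exact bZ s (by rw [abs_of_pos hs0]; exact hsZ'.le)
      calc _ ≤ s⁻¹ * (exp (s * h) * exp (n * (-(s * (t * h)) + Cq * s ^ 2))) *
            exp (n * (s * IZ + CZ * s ^ 2)) := by
            have z3 : 0 ≤ ∑ u, ∑ a, ∑ b, l u * (p u a * out W Prod.snd a b) *
                (out W Prod.snd a b / ∑ a, p u a * out W Prod.snd a b) ^ s :=
              Finset.sum_nonneg fun u _ => Finset.sum_nonneg fun a _ => Finset.sum_nonneg fun b _ =>
              mul_nonneg (mul_nonneg (hl0 _) (mul_nonneg (hp0 _ _)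
                ((isKernel_out W _).nonneg _ _)))
                (rpow_nonneg (div_nonneg ((isKernel_out W _).nonneg _ _)
                  (Finset.sum_nonneg fun a _ =>
                  mul_nonneg (hp0 _ _) ((isKernel_out W _).nonneg _ _))) _)
            exact mul_le_mul (mul_le_mul_of_nonneg_left f2 (inv_nonneg.2 hs0.le)) f3
              (pow_nonneg z3 _) (by positivity)
        _ = s⁻¹ * exp (s * h) * exp (n * ((-(s * (t * h)) + Cq * s ^ 2) +
            (s * IZ + CZ * s ^ 2))) := by
            rw [mul_add (n : ℝ) (_ + _) (_ + _), exp_add]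
            ring
        _ ≤ s⁻¹ * exp (s * h) * exp (n * (s * (IZ - t * h) + C * s ^ 2)) := by
            refine mul_le_mul_of_nonneg_left (exp_le_exp.2 (mul_le_mul_of_nonneg_left ?_
              (Nat.cast_nonneg n))) (by positivity)
            rw [hC]
            nlinarith [mul_nonneg hCY hs2]
        _ = _ := by rw [exp_nat_mul]
    -- Without randomness and with `I(X;Z|U) = 0`, the divergence part is exactly `0`.
    · refine ⟨0, -1, by norm_num, fun n => ?_⟩
      have hZ' : ∑ u, l u * weightInfo (p u) (out W Prod.snd) = 0 := hZ
      rw [hE0 n (by simp), hZ']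
      simp
  obtain ⟨K, y₂, hy₂, b2⟩ := b2
  have htot : Tendsto (fun n => 2 * exp y₁ ^ n + K * exp y₂ ^ n) atTop (𝓝 0) := by
    have h1 := (tendsto_pow_atTop_nhds_zero_of_lt_one (exp_pos y₁).le
      (exp_lt_one_iff.2 hy₁0)).const_mul 2
    have h2 := (tendsto_pow_atTop_nhds_zero_of_lt_one (exp_pos y₂).le
      (exp_lt_one_iff.2 hy₂)).const_mul K
    simpa using h1.add h2
  have hbound : ∀ n, (D n).errorProb W pS + (D n).leakage W pS * log 2 ≤
      2 * exp y₁ ^ n + K * exp y₂ ^ n := fun n =>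
    (hD n).trans (add_le_add (b1 n) (b2 n))
  have hl2 : 0 < log 2 := log_pos one_lt_two
  have herr0 : ∀ n, 0 ≤ (D n).errorProb W pS := fun n => ENNReal.toReal_nonneg
  have hleak0 : ∀ n, 0 ≤ (D n).leakage W pS := fun n => (D n).leakage_nonneg W pS
  refine ⟨hR, D, ?_, ?_⟩
  · refine squeeze_zero herr0 (fun n => ?_) htot
    have := hbound n
    have := mul_nonneg (hleak0 n) hl2.le
    linarith
  · have h1 : Tendsto (fun n => (D n).leakage W pS * log 2) atTop (𝓝 0) := by
      refine squeeze_zero (fun n => mul_nonneg (hleak0 n) hl2.le) (fun n => ?_) htot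
      have := hbound n
      have := herr0 n
      linarith
    simpa [hl2.ne'] using h1.mul_const (log 2)⁻¹

/-- A source can be quantized to a finite alphabet with arbitrarily small loss of entropy. -/
theorem exists_finite_quantization (pS : PMF S) {a : ℝ≥0∞} (ha : a < discreteEntropy pS) :
    ∃ (F : Finset S) (g : S → Option F), a < discreteEntropy (pS.map g) := by
  classical
  unfold discreteEntropy at ha
  rw [ENNReal.tsum_eq_iSup_sum, lt_iSup_iff] at ha
  obtain ⟨F, hF⟩ := ha
  -- Symbols of `F` are kept and all others merged into `none`; the entropy is then at least the
  -- partial sum over `F`.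
  refine ⟨F, fun x => if h : x ∈ F then some ⟨x, h⟩ else none, hF.trans_le ?_⟩
  have happ : ∀ x : F, pS.map (fun x => if h : x ∈ F then some (⟨x, h⟩ : F) else none) (some x) =
      pS x := fun x => by
    rw [PMF.map_apply, tsum_eq_single (x : S)]
    · simp
    · intro y hy
      rw [if_neg]
      split_ifs with h
      · intro h'
        rw [Option.some_inj] at h'
        exact hy (congrArg Subtype.val h').symm
      · simp
  rw [discreteEntropy, tsum_fintype, Fintype.sum_option, ← Finset.sum_coe_sort F]
  simp only [happ]
  exact le_add_self

theorem achievable_of_lt [Nonempty X] (W : X → PMF (Y × Z)) (pS : PMF S) {v : ℝ × ℝ}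
    (hv : v ∈ wiretapRegion W) (hH : ENNReal.ofReal (v.2 / log 2) ≤ discreteEntropy pS) {R : ℝ}
    (hR : 0 ≤ R) (hRv : R < (v.1 - v.2) / log 2) : Achievable W pS R := by
  have hl2 : 0 < log 2 := log_pos one_lt_two
  rw [lt_div_iff₀ hl2] at hRv
  have key : ∀ v ∈ wiretapRegion W, ∃ (U : Type) (_ : Fintype U) (l : U → ℝ) (p : U → X → ℝ),
      (∀ u, 0 ≤ l u) ∧ ∑ u, l u = 1 ∧ (∀ u x, 0 ≤ p u x) ∧ (∀ u, ∑ x, p u x = 1) ∧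
      ∑ u, l u * weightInfo (p u) (out W Prod.fst) = v.1 ∧
      ∑ u, l u * weightInfo (p u) (out W Prod.snd) = v.2 := by
    intro v hv
    obtain ⟨U, _, l, z, hl, hl1, hz, rfl⟩ := mem_convexHull_iff_exists_fintype.1 hv
    choose p hp hpz using hz
    refine ⟨U, inferInstance, l, p, hl, hl1, fun u => (hp u).1, fun u => (hp u).2, ?_, ?_⟩
    · simp [Prod.fst_sum, ← hpz]
    · simp [Prod.snd_sum, ← hpz]
  -- If `v.2 = 0` no randomness is needed, which covers a source of zero entropy.
  rcases (snd_nonneg_of_mem_wiretapRegion hv).eq_or_lt with h0 | h0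
  · obtain ⟨U, _, l, p, hl, hl1, hp, hp1, e1, e2⟩ := key v hv
    refine achievable_of_rates W pS (fun _ => ()) () hl hl1 hp hp1 (t := 0) hR le_rfl zero_le_one
      ?_ (Or.inr ⟨rfl, e2.trans h0.symm⟩)
    rw [e1]
    linarith
  · have hd : 0 < v.1 - v.2 := (mul_nonneg hR hl2.le).trans_lt hRv
    -- Moving `v` towards `0` by a factor `τ < 1` makes the entropy constraint strict, while `τ (v.1
    -- - v.2)` still exceeds `R log 2`.
    obtain ⟨τ, hτ1, hτ2⟩ := exists_between ((div_lt_one hd).2 hRv)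
    have hτ0 : 0 ≤ τ := (div_nonneg (mul_nonneg hR hl2.le) hd.le).trans hτ1.le
    rw [div_lt_iff₀ hd] at hτ1
    have hv' : τ • v ∈ wiretapRegion W :=
      (convex_convexHull ℝ _).smul_mem_of_zero_mem (zero_mem_wiretapRegion W) hv ⟨hτ0, hτ2.le⟩
    have hlt : ENNReal.ofReal (τ * v.2 / log 2) < discreteEntropy pS := by
      refine lt_of_lt_of_le ?_ hH
      rw [ENNReal.ofReal_lt_ofReal_iff (div_pos h0 hl2)]
      exact div_lt_div_of_pos_right (mul_lt_of_lt_one_left h0 hτ2) hl2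
    obtain ⟨F, g, hg⟩ := exists_finite_quantization pS hlt
    obtain ⟨U, _, l, p, hl, hl1, hp, hp1, e1, e2⟩ := key _ hv'
    simp only [Prod.smul_fst, Prod.smul_snd, smul_eq_mul] at e1 e2
    have hτv : 0 ≤ τ * v.2 := mul_nonneg hτ0 h0.le
    rw [discreteEntropy_eq_ofReal_entropy, ENNReal.ofReal_lt_ofReal_iff_of_nonneg
      (div_nonneg hτv hl2.le), entropy_eq, div_lt_div_iff_of_pos_right hl2] at hg
    set h := ∑ r, negMulLog (pS.map g r).toReal with hh
    have hpos : 0 < h := hτv.trans_lt hg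
    -- `x = t h` is the randomness spent per channel use: more than the eavesdropper's information,
    -- less than the source supplies, and leaving room for the rate `R`.
    obtain ⟨x, hx1, hx2⟩ := exists_between (lt_min hg
      (by linarith : τ * v.2 < τ * v.1 - R * log 2))
    have hx3 := hx2.trans_le (min_le_left _ _)
    have hx4 := hx2.trans_le (min_le_right _ _)
    refine achievable_of_rates W pS g none hl hl1 hp hp1 (t := x / h) hR
      (div_nonneg (hτv.trans hx1.le) hpos.le) ((div_le_one hpos).2 hx3.le) ?_ (Or.inl ?_)
    · rw [← hh, div_mul_cancel₀ _ hpos.ne', e1]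
      linarith
    · rw [← hh, div_mul_cancel₀ _ hpos.ne', e2]
      exact hx1

/-- A single message is never misread and never leaks. This makes the set of achievable rates
nonempty even when the capacity is `0`, where no rate lies strictly below it. -/
theorem achievable_zero [Nonempty X] (W : X → PMF (Y × Z)) (pS : PMF S) :
    Achievable W pS 0 := by
  have hl2 : 0 < log 2 := log_pos one_lt_two
  have hM : ∀ n, numMessages 0 n = 1 := fun n => by simp [numMessages]
  have hM' : ∀ n, (numMessages 0 n : ℝ) = 1 := fun n => by simp [numMessages]
  let C : ∀ n, Code S X Y (numMessages 0 n) n := fun n =>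
    ⟨fun _ _ _ => Classical.arbitrary X, fun _ => some 0⟩
  have herr : ∀ n, (C n).errorProb W pS = 0 := fun n => by
    have hm : ∀ m : Fin (numMessages 0 n), 0 = m := fun m => by
      have := m.2
      have := hM n
      ext
      simp only [Fin.val_zero]
      omega
    rw [Code.errorProb_eq]
    refine Finset.sum_eq_zero fun m _ => ?_
    rw [Finset.sum_eq_zero fun y _ => ?_, mul_zero]
    rw [if_pos (congrArg some (hm m)), mul_zero]
  have hleak : ∀ n, (C n).leakage W pS = 0 := fun n => by
    refine le_antisymm ?_ ((C n).leakage_nonneg W pS)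
    rw [Code.leakage_eq]
    refine div_nonpos_of_nonpos_of_nonneg ?_ hl2.le
    refine (weightInfo_le_sum_negMulLog _ (fun _ => inv_nonneg.2 (Nat.cast_nonneg _))
      ((C n).isKernel_kernel pS (isKernel_out W _))).trans ?_
    simp [hM']
  exact ⟨le_rfl, C, by simp only [herr]; exact tendsto_const_nhds,
    by simp only [hleak]; exact tendsto_const_nhds⟩

end achievability

end Wiretap

/-! ### The capacity formula -/

theorem proposition1 {S X Y Z : Type*} [Fintype X] [Nonempty X] [Fintype Y] [Fintype Z]
    (W : X → PMF (Y × Z)) (pS : PMF S) (hW : Wiretap.LessCapable W) :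
    IsLUB {R : ℝ | Wiretap.Achievable W pS R} (Wiretap.secrecyCapacity W pS) ∧
      IsGreatest (Wiretap.secrecyValues W pS) (Wiretap.secrecyCapacity W pS) := by
  obtain ⟨r, hr⟩ := Wiretap.exists_isGreatest_secrecyValues W pS
  obtain ⟨v, hv, hH, rfl⟩ := (Wiretap.mem_secrecyValues_iff W pS r).1 hr.1
  have hl2 : 0 < Real.log 2 := Real.log_pos one_lt_two
  have hle : ∀ R, Wiretap.Achievable W pS R → R ≤ (v.1 - v.2) / Real.log 2 := by
    intro R hR
    obtain ⟨u, hu, hu', hRu⟩ := hR.exists_mem_wiretapRegion hW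
    rw [← le_div_iff₀ hl2] at hRu
    exact hRu.trans (hr.2 ((Wiretap.mem_secrecyValues_iff W pS _).2 ⟨u, hu, hu', rfl⟩))
  have hzero := Wiretap.achievable_zero W pS
  have hlub : IsLUB {R : ℝ | Wiretap.Achievable W pS R} ((v.1 - v.2) / Real.log 2) := by
    refine ⟨fun R hR => hle R hR, fun b hb => le_of_not_gt fun hlt => ?_⟩
    obtain ⟨R, hbR, hR⟩ := exists_between hlt
    -- An upper bound is nonnegative because rate `0` is achievable, so the rate chosen above `b` is
    -- admissible in `achievable_of_lt`.
    have hb0 : 0 ≤ b := hb hzero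
    exact absurd (hb (Wiretap.achievable_of_lt W pS hv hH (hb0.trans hbR.le) hR)) (not_le.2 hbR)
  have hcap : Wiretap.secrecyCapacity W pS = (v.1 - v.2) / Real.log 2 :=
    hlub.csSup_eq ⟨0, hzero⟩
  rw [hcap]
  exact ⟨hlub, hr⟩
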